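/- **Definitions.** For a finite poset $P$ let $L(P)$ be the lattice of its (lower) order ideals, including $\emptyset$ and $P$, ordered by inclusion; it is ranked by cardinality, $\operatorname{rk} I=\#I$, so its rank is $N=\#P$. Let $r_k$ be the number of elements of rank $k$. The rank sequence $(r_0,\dots,r_N)$ is *symmetric* if $r_k=r_{N-k}$ for all $k<N/2$, *top heavy* if $r_k\le r_{N-k}$ for all $k<N/2$, *top interlacing* if $r_0\le r_N\le r_1\le r_{N-1}\le\cdots\le r_{\lceil N/2\rceil}$, and *bottom interlacing* if $r_N\le r_0\le r_{N-1}\le r_1\le\cdots\le r_{\lfloor N/2\rfloor}$. In a ranked poset of rank $N$, a saturated chain $C$ with least element $x$ and greatest element $y$ has center $\operatorname{cen} C=(\operatorname{rk}x+\operatorname{rk}y)/2$ and interval $[C]=[\operatorname{rk}x,\operatorname{rk}y]$. A *chain decomposition* (CD) is a partition of the poset into saturated chains. A CD is *nested* (an NCD) if for any two of its chains $C,D$ either $[C]\subseteq[D]$ or $[D]\subseteq[C]$. It is *symmetric* if $\operatorname{cen}C=N/2$ for each of its chains $C$, *top centered* if $\operatorname{cen}C\in\{N/2,(N+1)/2\}$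 for each $C$, and *bottom centered* if $\operatorname{cen}C\in\{N/2,(N-1)/2\}$ for each $C$. For positive integers $n,d$ write $n=qd+r$ with $0\le r<d$. The *$d$-divided poset* $P_{n,d}$ is the poset on $\{1,\dots,n\}$ with covering relations $$d\rhd d-1\rhd\cdots\rhd 1\lhd 2d\rhd 2d-1\rhd\cdots\rhd d+1\lhd 3d\rhd\cdots\lhd n\rhd n-1\rhd\cdots\rhd qd+1$$ (the last block $n\rhd\cdots\rhd qd+1$ is absent if $r=0$). For a composition $\alpha=(\alpha_1,\dots,\alpha_s)$ of $n-1$ into positive parts (the empty composition if $n=1$), the *fence* $F(\alpha)$ is the poset on $x_1,\dots,x_n$ with covering relations $x_1\lhd\cdots\lhd x_{\alpha_1+1}\rhd\cdots\rhd x_{\alpha_1+\alpha_2+1}\lhd\cdots$. Put $L(\alpha)=L(F(\alpha))$ and let $r(\alpha)$ be its rank sequence. The *centered decomposition conjecture for $\alpha$* says the following. * If $s=1$, then $L(\alpha)$ has a symmetric CD. * If $s$ is even, then $L(\alpha)$ has a bottom centered CD. * If $s\ge3$ is odd, then $L(\alpha)$ has a bottom centered CD when $\alpha_1>\alpha_s$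 and a top centered CD when $\alpha_1<\alpha_s$. When $\alpha_1=\alpha_s$, let $\alpha'=(\alpha_2,\dots,\alpha_{s-1})$; then $r(\alpha')$ is symmetric, top interlacing or bottom interlacing, and $L(\alpha)$ has a CD which is symmetric, bottom centered or top centered, respectively. **Theorem 5.1.** Let $n,d$ be positive integers. 1. If $d\mid n$, then $L(P_{n,d})$ has a nested chain decomposition which is symmetric, and its rank sequence is symmetric. 2. If $d\nmid n$, then $L(P_{n,d})$ has a nested chain decomposition which is top centered, and its rank sequence is top interlacing and, in particular, top heavy. 3. Dually, there is a composition $\alpha$ of $n-1$ such that the dual poset $P_{n,d}^*$ is isomorphic to $F(\alpha)$ and the centered decomposition conjecture holds for $\alpha$; moreover $L(\alpha)$ has a nested chain decomposition which is symmetric if $d\mid n$ and bottom centered if $d\nmid n$. -/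

import Mathlib

/-! ### Ranked posets, rank sequences and chain decompositions

A ranked poset is a `GradeMinOrder ℕ`: `grade ℕ x` is `0` at minimal elements and goes up by exactly
one along covering relations, so it is the length of every saturated chain from a minimal element
up to `x`. -/

/-- The rank of a (finite) ranked poset: the maximum of the ranks of its elements. -/
noncomputable def posetRank (P : Type*) [PartialOrder P] [GradeMinOrder ℕ P] : ℕ :=
  ⨆ x : P, grade ℕ x

/-- The rank sequence: `rankSeq P k` is the number of elements of rank `k`. -/
noncomputable def rankSeq (P : Type*) [PartialOrder P] [GradeMinOrder ℕ P] (k : ℕ) : ℕ :=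
  Set.ncard {x : P | grade ℕ x = k}

/-- The sequence `a 0, …, a n` is symmetric. -/
def SymmetricSeq (a : ℕ → ℕ) (n : ℕ) : Prop :=
  ∀ k, 2 * k < n → a k = a (n - k)

/-- The sequence `a 0, …, a n` is top heavy. -/
def TopHeavySeq (a : ℕ → ℕ) (n : ℕ) : Prop :=
  ∀ k, 2 * k < n → a k ≤ a (n - k)

/-- The sequence `a 0, …, a n` is top interlacing:
`a 0 ≤ a n ≤ a 1 ≤ a (n - 1) ≤ ⋯ ≤ a ⌈n / 2⌉`. -/
def TopInterlacingSeq (a : ℕ → ℕ) (n : ℕ) : Prop :=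
  (∀ k, 2 * k < n → a k ≤ a (n - k)) ∧ (∀ k, 2 * k + 1 < n → a (n - k) ≤ a (k + 1))

/-- The sequence `a 0, …, a n` is bottom interlacing:
`a n ≤ a 0 ≤ a (n - 1) ≤ a 1 ≤ ⋯ ≤ a ⌊n / 2⌋`. -/
def BottomInterlacingSeq (a : ℕ → ℕ) (n : ℕ) : Prop :=
  (∀ k, 2 * k < n → a (n - k) ≤ a k) ∧ (∀ k, 2 * k + 1 < n → a k ≤ a (n - (k + 1)))

/-- A saturated chain `x = c₀ ⋖ c₁ ⋖ ⋯ ⋖ c_m = y`; its endpoints are `C.head` and `C.last`. -/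
abbrev SaturatedChain (P : Type*) [PartialOrder P] : Type _ :=
  RelSeries {p : P × P | p.1 ⋖ p.2}

/-- The center of a saturated `x`–`y` chain, the rational number `(rk x + rk y) / 2`. -/
noncomputable def SaturatedChain.center {P : Type*} [PartialOrder P] [GradeMinOrder ℕ P]
    (C : SaturatedChain P) : ℚ :=
  ((grade ℕ C.head : ℚ) + (grade ℕ C.last : ℚ)) / 2

/-- The interval `[rk x, rk y]` of a saturated `x`–`y` chain. -/
def SaturatedChain.interval {P : Type*} [PartialOrder P] [GradeMinOrder ℕ P]
    (C : SaturatedChain P) : Set ℕ :=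
  Set.Icc (grade ℕ C.head) (grade ℕ C.last)

/-- A chain decomposition: a partition of `P` into saturated chains. -/
def IsCD {P : Type*} [PartialOrder P] (𝒞 : Set (SaturatedChain P)) : Prop :=
  ∀ x : P, ∃! C : SaturatedChain P, C ∈ 𝒞 ∧ x ∈ C

/-- A nested chain decomposition. -/
def IsNCD {P : Type*} [PartialOrder P] [GradeMinOrder ℕ P] (𝒞 : Set (SaturatedChain P)) : Prop :=
  IsCD 𝒞 ∧ ∀ C ∈ 𝒞, ∀ D ∈ 𝒞,
    SaturatedChain.interval C ⊆ SaturatedChain.interval D ∨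
      SaturatedChain.interval D ⊆ SaturatedChain.interval C

/-- A symmetric chain decomposition: every chain has center `n / 2`, where `n` is the rank. -/
def IsSymmetricCD {P : Type*} [PartialOrder P] [GradeMinOrder ℕ P]
    (𝒞 : Set (SaturatedChain P)) : Prop :=
  IsCD 𝒞 ∧ ∀ C ∈ 𝒞, SaturatedChain.center C = (posetRank P : ℚ) / 2

/-- A top centered chain decomposition: every chain has center `n / 2` or `(n + 1) / 2`. -/
def IsTopCenteredCD {P : Type*} [PartialOrder P] [GradeMinOrder ℕ P]
    (𝒞 : Set (SaturatedChain P)) : Prop :=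
  IsCD 𝒞 ∧ ∀ C ∈ 𝒞, SaturatedChain.center C = (posetRank P : ℚ) / 2 ∨
    SaturatedChain.center C = ((posetRank P : ℚ) + 1) / 2

/-- A bottom centered chain decomposition: every chain has center `n / 2` or `(n - 1) / 2`. -/
def IsBottomCenteredCD {P : Type*} [PartialOrder P] [GradeMinOrder ℕ P]
    (𝒞 : Set (SaturatedChain P)) : Prop :=
  IsCD 𝒞 ∧ ∀ C ∈ 𝒞, SaturatedChain.center C = (posetRank P : ℚ) / 2 ∨
    SaturatedChain.center C = ((posetRank P : ℚ) - 1) / 2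

/-! ### The lattice of order ideals

The lattice `L(P)` of (lower) order ideals is `LowerSet P`; for finite `P` it is ranked by the
cardinality of the ideals. -/

theorem LowerSet.ncard_of_covBy {P : Type*} [PartialOrder P] [Finite P] {I J : LowerSet P}
    (h : I ⋖ J) : (J : Set P).ncard = (I : Set P).ncard + 1 := by
  obtain ⟨hlt, hcov⟩ := h
  have hsub : (I : Set P) ⊂ (J : Set P) := hlt
  have hne : ((J : Set P) \ (I : Set P)).Nonempty := Set.nonempty_of_ssubset hsub
  obtain ⟨x, hx⟩ := (Set.toFinite ((J : Set P) \ (I : Set P))).exists_minimal hne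
  have hxJ : x ∈ (J : Set P) := hx.prop.1
  have hxI : x ∉ (I : Set P) := hx.prop.2
  let K : LowerSet P := ⟨insert x (I : Set P), by
    intro a b hba ha
    rcases Set.mem_insert_iff.1 ha with rfl | ha
    · by_cases hb : b ∈ (I : Set P)
      · exact Set.mem_insert_of_mem _ hb
      · have hab := hx.le_of_le ⟨J.lower hba hxJ, hb⟩ hba
        exact Set.mem_insert_iff.2 (Or.inl (le_antisymm hba hab))
    · exact Set.mem_insert_of_mem _ (I.lower hba ha)⟩
  have hIK : I < K := by
    refine lt_of_le_of_ne (fun a ha => Set.mem_insert_of_mem _ ha) (fun e => hxI ?_)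
    have : x ∈ (K : Set P) := Set.mem_insert _ _
    rwa [← e] at this
  have hKJ : K ≤ J := fun a ha => by
    rcases Set.mem_insert_iff.1 ha with rfl | ha
    · exact hxJ
    · exact hsub.1 ha
  have hK : K = J := by
    by_contra hKne
    exact hcov hIK (lt_of_le_of_ne hKJ hKne)
  rw [← hK]
  exact Set.ncard_insert_of_notMem hxI (Set.toFinite _)

noncomputable instance LowerSet.instGradeMinOrderNat {P : Type*} [PartialOrder P] [Finite P] :
    GradeMinOrder ℕ (LowerSet P) where
  grade I := (I : Set P).ncard
  grade_strictMono I J h := Set.ncard_lt_ncard (show (I : Set P) ⊂ (J : Set P) from h)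
    (Set.toFinite _)
  covBy_grade I J h := by
    rw [Nat.covBy_iff_add_one_eq]
    exact (LowerSet.ncard_of_covBy h).symm
  isMin_grade I h := by
    have hI : I = ⊥ := isMin_iff_eq_bot.1 h
    subst hI
    simp

/-! ### Posets given by covering relations -/

/-- The partial order generated by a relation `R` along which some integer function increases:
the reflexive transitive closure of `R`. -/
@[reducible] def posetOfCovers {V : Type*} (R : V → V → Prop) (h : V → ℤ) (hR : ∀ a b, R a b → h a < h b) :
    PartialOrder V where
  le := Relation.ReflTransGen R
  le_refl _ := Relation.ReflTransGen.refl
  le_trans _ _ _ := Relation.ReflTransGen.trans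
  le_antisymm a b hab hba := by
    have key : ∀ {x y : V}, Relation.ReflTransGen R x y → x = y ∨ h x < h y := by
      intro x y hxy
      induction hxy with
      | refl => exact Or.inl rfl
      | tail _ hbc ih =>
        rcases ih with rfl | ih
        · exact Or.inr (hR _ _ hbc)
        · exact Or.inr (ih.trans (hR _ _ hbc))
    rcases key hab with e | h1
    · exact e
    · rcases key hba with e | h2
      · exact e.symm
      · exact absurd (h1.trans h2) (lt_irrefl _)

/-! ### The `d`-divided poset -/

/-- The covering relations `i ⊲ j` of the `d`-divided poset, in terms of the labels
`i, j ∈ {1, …, n}`.  The labels are cut into the blocks `{kd + 1, …, (k + 1)d}`, the last of which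
stops at `n`.  Each block is a chain, and the smallest label `kd + 1` of a block is covered by
the largest label of the next block (if there is a next block). -/
def DDividedCover (n d i j : ℕ) : Prop :=
  (j = i + 1 ∧ ¬ d ∣ i) ∨ ∃ k, i = k * d + 1 ∧ (k + 1) * d < n ∧ j = min ((k + 2) * d) n

/-- The ground set of the `d`-divided poset `P_{n,d}`; the element `i : Fin n` carries the
label `i + 1`, so that the labels are `1, …, n`. -/
def DDivided (n _d : ℕ) : Type := Fin n

/-- The label in `{1, …, n}` of an element of `P_{n,d}`. -/
def DDivided.label {n d : ℕ} (x : DDivided n d) : ℕ := Fin.val (n := n) x + 1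

instance DDivided.instFinite (n d : ℕ) : Finite (DDivided n d) := inferInstanceAs (Finite (Fin n))

theorem DDividedCover.lt {n d i j : ℕ} (h : DDividedCover n d i j) (hj : 0 < j) : i < j := by
  rcases h with ⟨rfl, _⟩ | ⟨k, rfl, hk, rfl⟩
  · exact Nat.lt_succ_self i
  · rcases Nat.eq_zero_or_pos d with rfl | hd
    · simp at hj
    · rw [lt_min_iff]
      constructor <;> nlinarith

instance DDivided.instPartialOrder (n d : ℕ) : PartialOrder (DDivided n d) :=
  posetOfCovers (fun x y => DDividedCover n d x.label y.label) (fun x => (x.label : ℤ))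
    (fun _ _ h => by exact_mod_cast h.lt (Nat.succ_pos _))

/-! ### Fences -/

/-- For a list of parts `(a, b, c, …)`, whether the `i`th step (counted from `0`) of the path
`x₁, x₂, x₃, …` goes up: the first `a` steps go up, the next `b` go down, the next `c` up, … -/
def StepUp : List ℕ → ℕ → Prop
  | [], _ => True
  | a :: l, i => i < a ∨ ¬ StepUp l (i - a)

/-- The ground set `x₁, …, x_n` of the fence `F(α)`, where `α` is a composition of `m = n - 1`;
the element `i : Fin (m + 1)` is `x_{i+1}`. -/
def Fence {m : ℕ} (_α : Composition m) : Type := Fin (m + 1)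

/-- The (zero-based) position along the path of an element of a fence. -/
def Fence.pos {m : ℕ} {α : Composition m} (x : Fence α) : ℕ := Fin.val (n := m + 1) x

instance Fence.instFinite {m : ℕ} (α : Composition m) : Finite (Fence α) :=
  inferInstanceAs (Finite (Fin (m + 1)))

/-- The covering relations of the fence with the given list of parts, in terms of positions. -/
def FenceCover (l : List ℕ) (i j : ℕ) : Prop :=
  (j = i + 1 ∧ StepUp l i) ∨ (i = j + 1 ∧ ¬ StepUp l j)

open Classical in
/-- The height of the path at position `i`. -/
noncomputable def pathHeight (l : List ℕ) (i : ℕ) : ℤ :=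
  ∑ k ∈ Finset.range i, if StepUp l k then 1 else -1

theorem FenceCover.pathHeight_lt {l : List ℕ} {i j : ℕ} (h : FenceCover l i j) :
    pathHeight l i < pathHeight l j := by
  rcases h with ⟨rfl, h⟩ | ⟨rfl, h⟩ <;> simp [pathHeight, Finset.sum_range_succ, h]

noncomputable instance Fence.instPartialOrder {m : ℕ} (α : Composition m) : PartialOrder (Fence α) :=
  posetOfCovers (fun x y => FenceCover α.blocks x.pos y.pos) (fun x => pathHeight α.blocks x.pos)
    (fun _ _ h => h.pathHeight_lt)

/-- The composition `α' = (α₂, …, α_{s-1})` obtained by dropping the first and the last part. -/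
def innerComposition {m : ℕ} (α : Composition m) : Composition α.blocks.tail.dropLast.sum where
  blocks := α.blocks.tail.dropLast
  blocks_pos h := α.blocks_pos (List.mem_of_mem_tail (List.mem_of_mem_dropLast h))
  blocks_sum := rfl

/-- The rank sequence `r(α)` of the lattice `L(α)` of order ideals of the fence `F(α)`. -/
noncomputable def fenceRankSeq {m : ℕ} (α : Composition m) : ℕ → ℕ := rankSeq (LowerSet (Fence α))

/-- The conjectured behaviour of `L(α)` for `α = (α₁, …, α_s)`: it has a chain decomposition that
is symmetric if `s = 1`, bottom centered if `s` is even, and, if `s ≥ 3` is odd, bottom centered if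
`α₁ > α_s`, top centered if `α₁ < α_s`, while for `α₁ = α_s` it is symmetric, bottom centered or top
centered depending on whether `r(α')` is symmetric, top interlacing or bottom interlacing (one of
which is the case), where `α' = (α₂, …, α_{s-1})`.  Here `m + 1` is the number of elements of
the fence, and `α'` is a composition of a number `m'`, so that `r(α')` is indexed
by `0, …, m' + 1`. -/
def CenteredConjectureHolds {m : ℕ} (α : Composition m) : Prop :=
  let L := LowerSet (Fence α)
  let α₁ : ℕ := α.blocks.headD 0
  let αs : ℕ := α.blocks.getLastD 0
  let r' : ℕ → ℕ := fenceRankSeq (innerComposition α)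
  let n' : ℕ := α.blocks.tail.dropLast.sum + 1
  (α.length = 1 → ∃ 𝒞 : Set (SaturatedChain L), IsSymmetricCD 𝒞) ∧
  (Even α.length → ∃ 𝒞 : Set (SaturatedChain L), IsBottomCenteredCD 𝒞) ∧
  (3 ≤ α.length → Odd α.length →
    (αs < α₁ → ∃ 𝒞 : Set (SaturatedChain L), IsBottomCenteredCD 𝒞) ∧
    (α₁ < αs → ∃ 𝒞 : Set (SaturatedChain L), IsTopCenteredCD 𝒞) ∧
    (α₁ = αs →
      (SymmetricSeq r' n' ∨ TopInterlacingSeq r' n' ∨ BottomInterlacingSeq r' n') ∧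
      (SymmetricSeq r' n' → ∃ 𝒞 : Set (SaturatedChain L), IsSymmetricCD 𝒞) ∧
      (TopInterlacingSeq r' n' → ∃ 𝒞 : Set (SaturatedChain L), IsBottomCenteredCD 𝒞) ∧
      (BottomInterlacingSeq r' n' → ∃ 𝒞 : Set (SaturatedChain L), IsTopCenteredCD 𝒞)))

/-! Write n = qd + r with 0 < r ≤ d: the last block is never empty, and d ∣ n means r = d. An order
ideal meets each block in an initial segment, so it is a word c_0 … c_q of sizes; besides the block
sizes, the only constraint is that a full block forces the preceding one to be nonempty.

Without that constraint the words form a product of chains, and Greene–Kleitman bracketing applies: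
c_i closing brackets, then one opening bracket per missing element of block i, and going up flips
the first unmatched opening bracket. The matching is preserved, which centers every chain at half
the rank. An empty block followed by a full one, both of size d, is matched within itself, so such
forbidden pairs persist along chains and can be discarded. Only a last block with r < d is
troublesome, because d − r brackets of the empty block before it stay open. Hence the words whose
last letter is full and matched entirely in the preceding block (`Special`) are split off. The other
words keep their symmetric chains (`IsWord.up_of_not_special`, `IsWord.down_of_not_special`). An
admissible special word has c_q = r and 1 ≤ c_{q-1} ≤ d − r; bracketing its first q letters within
these bounds gives chains whose end ranks sum to n + 1 (`IsWord.center`). There are none if r = d or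
q = 0.

Moving along such chains injects ranks into ranks, which gives the rank inequalities. Complementing
ideals dualizes the chains, and `DDivided.exists_fence` identifies the dual poset: for d > 1 the
parts are d − 1, 1, …, d − 1, 1, r − 1. If the number of parts is odd and at least 3, equal outer
parts mean r = d; then the chains are symmetric, and the inner fence is self-dual, so its rank
sequence is symmetric. -/

/-- A partition of a poset into saturated chains, described by the successor relation along the
chains: `above x` and `below x` count the elements of the chain of `x` above and below `x`. -/
structure ChainSystem (P : Type*) [PartialOrder P] where
  step : P → P → Prop
  above : P → ℕ
  below : P → ℕ
  covBy : ∀ {x y}, step x y → x ⋖ y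
  above_eq : ∀ {x y}, step x y → above x = above y + 1
  below_eq : ∀ {x y}, step x y → below y = below x + 1
  exists_next : ∀ {x}, above x ≠ 0 → ∃ y, step x y
  exists_prev : ∀ {y}, below y ≠ 0 → ∃ x, step x y
  next_unique : ∀ {x y z}, step x y → step x z → y = z
  prev_unique : ∀ {x y z}, step x z → step y z → x = y

namespace ChainSystem

variable {P Q : Type*} [PartialOrder P] [PartialOrder Q]

/-- The chain system on an order-dual poset. -/
def dual (S : ChainSystem P) (e : Q ≃o Pᵒᵈ) : ChainSystem Q where
  step x y := S.step (OrderDual.ofDual (e y)) (OrderDual.ofDual (e x))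
  above x := S.below (OrderDual.ofDual (e x))
  below x := S.above (OrderDual.ofDual (e x))
  covBy h := (apply_covBy_apply_iff e).1 (S.covBy h).toDual
  above_eq h := S.below_eq h
  below_eq h := S.above_eq h
  exists_next h := by
    obtain ⟨z, hz⟩ := S.exists_prev h
    exact ⟨e.symm (OrderDual.toDual z), by simpa using hz⟩
  exists_prev h := by
    obtain ⟨z, hz⟩ := S.exists_next h
    exact ⟨e.symm (OrderDual.toDual z), by simpa using hz⟩
  next_unique h h' := e.injective (OrderDual.ofDual.injective (S.prev_unique h h'))
  prev_unique h h' := e.injective (OrderDual.ofDual.injective (S.next_unique h h'))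

open Classical in
/-- The successor along the chain, the element itself at the top of its chain. -/
noncomputable def next (S : ChainSystem P) (x : P) : P :=
  if h : S.above x ≠ 0 then (S.exists_next h).choose else x

theorem step_next (S : ChainSystem P) {x : P} (h : S.above x ≠ 0) : S.step x (S.next x) := by
  rw [next, dif_pos h]
  exact (S.exists_next h).choose_spec

theorem above_iterate (S : ChainSystem P) {x : P} {j k : ℕ} (h : S.above x = j + k) :
    S.above (S.next^[j] x) = k := by
  induction j generalizing k with
  | zero => simpa using h
  | succ j ih =>
    rw [Function.iterate_succ_apply']
    have h1 := ih (k := k + 1) (by omega)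
    have := S.above_eq (S.step_next (x := S.next^[j] x) (by omega))
    omega

theorem step_iterate (S : ChainSystem P) {x : P} {j : ℕ} (h : j < S.above x) :
    S.step (S.next^[j] x) (S.next^[j + 1] x) := by
  rw [Function.iterate_succ_apply']
  apply S.step_next
  rw [S.above_iterate (x := x) (j := j) (k := S.above x - j) (by omega)]
  omega

theorem below_iterate (S : ChainSystem P) {x : P} {j : ℕ} (h : j ≤ S.above x) :
    S.below (S.next^[j] x) = S.below x + j := by
  induction j with
  | zero => simp
  | succ j ih => rw [S.below_eq (S.step_iterate (by omega)), ih (by omega), add_assoc]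

theorem iterate_injective (S : ChainSystem P) {x y : P} {j : ℕ} (hx : j ≤ S.above x)
    (hy : j ≤ S.above y) (h : S.next^[j] x = S.next^[j] y) : x = y := by
  induction j with
  | zero => simpa using h
  | succ j ih =>
    apply ih (by omega) (by omega)
    have h1 := S.step_iterate (x := x) (j := j) (by omega)
    have h2 := S.step_iterate (x := y) (j := j) (by omega)
    rw [h] at h1
    exact S.prev_unique h1 h2

theorem exists_iterate_eq (S : ChainSystem P) (y : P) :
    ∃ x, S.below x = 0 ∧ S.above x = S.below y + S.above y ∧ S.next^[S.below y] x = y := by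
  generalize hb : S.below y = b
  induction b generalizing y with
  | zero => exact ⟨y, hb, by simp, rfl⟩
  | succ b ih =>
    obtain ⟨z, hz⟩ := S.exists_prev (y := y) (by omega)
    have h1 := S.below_eq hz
    have h2 := S.above_eq hz
    obtain ⟨x, hx0, hxa, hx⟩ := ih z (by omega)
    refine ⟨x, hx0, by omega, ?_⟩
    rw [Function.iterate_succ_apply', hx]
    exact S.next_unique (S.step_next (by omega)) hz

/-- The chain starting at a given element. -/
noncomputable def chainFrom (S : ChainSystem P) (x : P) : SaturatedChain P where
  length := S.above x
  toFun i := S.next^[i] x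
  step i := S.covBy (S.step_iterate i.2)

theorem mem_chainFrom (S : ChainSystem P) {x y : P} :
    y ∈ S.chainFrom x ↔ ∃ j ≤ S.above x, S.next^[j] x = y := by
  constructor
  · rintro ⟨i, rfl⟩
    exact ⟨i, Nat.lt_succ_iff.1 i.2, rfl⟩
  · rintro ⟨j, hj, rfl⟩
    exact ⟨⟨j, Nat.lt_succ_iff.2 hj⟩, rfl⟩

/-- The chains of a chain system. -/
def chains (S : ChainSystem P) : Set (SaturatedChain P) :=
  S.chainFrom '' {x | S.below x = 0}

theorem isCD_chains (S : ChainSystem P) : IsCD S.chains := by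
  intro y
  obtain ⟨x, hx0, hxa, hx⟩ := S.exists_iterate_eq y
  refine ⟨S.chainFrom x, ⟨⟨x, hx0, rfl⟩, S.mem_chainFrom.2 ⟨_, by omega, hx⟩⟩, ?_⟩
  rintro _ ⟨⟨z, hz0, rfl⟩, hz⟩
  obtain ⟨j, hj, hjz⟩ := S.mem_chainFrom.1 hz
  have hb := S.below_iterate hj
  rw [hjz, show S.below z = 0 from hz0, zero_add] at hb
  rw [hb] at hx hxa
  rw [S.iterate_injective hj (by omega) (hjz.trans hx.symm)]

variable [GradeMinOrder ℕ P]

theorem grade_of_step (S : ChainSystem P) {x y : P} (h : S.step x y) :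
    grade ℕ y = grade ℕ x + 1 :=
  (Nat.covBy_iff_add_one_eq.1 ((S.covBy h).grade ℕ)).symm

theorem grade_iterate (S : ChainSystem P) {x : P} {j : ℕ} (h : j ≤ S.above x) :
    grade ℕ (S.next^[j] x) = grade ℕ x + j := by
  induction j with
  | zero => simp
  | succ j ih => rw [S.grade_of_step (S.step_iterate (by omega)), ih (by omega), add_assoc]

theorem exists_of_mem_chains (S : ChainSystem P) {C : SaturatedChain P} (hC : C ∈ S.chains) :
    ∃ x, S.below x = 0 ∧ grade ℕ C.head = grade ℕ x ∧
      grade ℕ C.last = grade ℕ x + S.above x := by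
  obtain ⟨x, hx, rfl⟩ := hC
  exact ⟨x, hx, rfl, S.grade_iterate le_rfl⟩

/-- If every element of rank `k` has at least `j` elements above it on its chain, then there are
at least as many elements of rank `k + j`. -/
theorem rankSeq_le_of_above [Finite P] (S : ChainSystem P) {k j : ℕ}
    (h : ∀ x : P, grade ℕ x = k → j ≤ S.above x) : rankSeq P k ≤ rankSeq P (k + j) := by
  refine Set.ncard_le_ncard_of_injOn (S.next^[j]) ?_ ?_ (Set.toFinite _)
  · intro x hx
    have hx : grade ℕ x = k := hx
    change grade ℕ _ = _
    rw [S.grade_iterate (h x hx), hx]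
  · intro x hx y hy hxy
    exact S.iterate_injective (h x hx) (h y hy) hxy

/-- Each y is assigned a preimage under `next^[j]`; applying `next^[j]` recovers y, so the
assignment is injective. -/
theorem rankSeq_le_of_below [Finite P] (S : ChainSystem P) {k j : ℕ}
    (h : ∀ y : P, grade ℕ y = k + j → j ≤ S.below y) : rankSeq P (k + j) ≤ rankSeq P k := by
  have key : ∀ y : P, grade ℕ y = k + j →
      ∃ x, grade ℕ x = k ∧ j ≤ S.above x ∧ S.next^[j] x = y := by
    intro y hy
    obtain ⟨x, hx0, hxa, hx⟩ := S.exists_iterate_eq y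
    have hj := h y hy
    have h1 : S.next^[j] (S.next^[S.below y - j] x) = y := by
      rw [← Function.iterate_add_apply, Nat.add_sub_cancel' hj, hx]
    have h2 := S.above_iterate (x := x) (j := S.below y - j) (k := j + S.above y) (by omega)
    have h3 := S.grade_iterate (x := S.next^[S.below y - j] x) (j := j) (by omega)
    rw [h1] at h3
    exact ⟨_, by omega, by omega, h1⟩
  choose! f hf using key
  refine Set.ncard_le_ncard_of_injOn f (fun y hy => (hf y hy).1) ?_ (Set.toFinite _)
  intro y hy z hz hyz
  rw [← (hf y hy).2.2, ← (hf z hz).2.2, hyz]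

/-- If neither interval contained the other, both ends of one would lie strictly below those of the
other, and the end sums would differ by at least 2. -/
theorem isNCD_chains (S : ChainSystem P) (M : ℕ)
    (h : ∀ C ∈ S.chains, M ≤ grade ℕ C.head + grade ℕ C.last ∧
      grade ℕ C.head + grade ℕ C.last ≤ M + 1) : IsNCD S.chains := by
  refine ⟨S.isCD_chains, fun C hC D hD => ?_⟩
  obtain ⟨x, -, hx1, hx2⟩ := S.exists_of_mem_chains hC
  obtain ⟨y, -, hy1, hy2⟩ := S.exists_of_mem_chains hD
  have h1 := h C hC
  have h2 := h D hD
  rw [SaturatedChain.interval, SaturatedChain.interval,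
    Set.Icc_subset_Icc_iff (by omega), Set.Icc_subset_Icc_iff (by omega)]
  omega

/-! ### Centered chain systems and rank inequalities -/

/-- A chain system all of whose chains `[i, j]` satisfy `i + j = N`. -/
def IsSymmetric (S : ChainSystem P) : Prop :=
  ∀ x, 2 * grade ℕ x + S.above x = posetRank P + S.below x

/-- A chain system all of whose chains `[i, j]` satisfy `i + j = N` or `i + j = N + 1`. -/
def IsTopCentered (S : ChainSystem P) : Prop :=
  ∀ x, 2 * grade ℕ x + S.above x = posetRank P + S.below x ∨
    2 * grade ℕ x + S.above x = posetRank P + 1 + S.below x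

/-- A chain system all of whose chains `[i, j]` satisfy `i + j = N` or `i + j = N - 1`. -/
def IsBottomCentered (S : ChainSystem P) : Prop :=
  ∀ x, 2 * grade ℕ x + S.above x = posetRank P + S.below x ∨
    2 * grade ℕ x + S.above x + 1 = posetRank P + S.below x

theorem IsSymmetric.isTopCentered {S : ChainSystem P} (h : S.IsSymmetric) : S.IsTopCentered :=
  fun x => Or.inl (h x)

theorem IsSymmetric.isBottomCentered {S : ChainSystem P} (h : S.IsSymmetric) :
    S.IsBottomCentered :=
  fun x => Or.inl (h x)

theorem IsSymmetric.isNCD {S : ChainSystem P} (h : S.IsSymmetric) :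
    IsNCD S.chains ∧ IsSymmetricCD S.chains := by
  have key : ∀ C ∈ S.chains, grade ℕ C.head + grade ℕ C.last = posetRank P := by
    intro C hC
    obtain ⟨x, h0, h1, h2⟩ := S.exists_of_mem_chains hC
    have := h x
    omega
  refine ⟨S.isNCD_chains (posetRank P) (fun C hC => by have := key C hC; omega),
    S.isCD_chains, fun C hC => ?_⟩
  rw [SaturatedChain.center, ← key C hC]
  push_cast
  ring

theorem IsTopCentered.isNCD {S : ChainSystem P} (h : S.IsTopCentered) :
    IsNCD S.chains ∧ IsTopCenteredCD S.chains := by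
  have key : ∀ C ∈ S.chains, grade ℕ C.head + grade ℕ C.last = posetRank P ∨
      grade ℕ C.head + grade ℕ C.last = posetRank P + 1 := by
    intro C hC
    obtain ⟨x, h0, h1, h2⟩ := S.exists_of_mem_chains hC
    have := h x
    omega
  refine ⟨S.isNCD_chains (posetRank P) (fun C hC => by have := key C hC; omega),
    S.isCD_chains, fun C hC => ?_⟩
  rw [SaturatedChain.center]
  refine (key C hC).imp (fun h => ?_) (fun h => ?_)
  · rw [← h]; push_cast; rfl
  · have : ((posetRank P : ℚ) + 1) = ((posetRank P + 1 : ℕ) : ℚ) := by push_cast; rfl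
    rw [this, ← h]; push_cast; rfl

theorem IsBottomCentered.isNCD {S : ChainSystem P} (h : S.IsBottomCentered) :
    IsNCD S.chains ∧ IsBottomCenteredCD S.chains := by
  have key : ∀ C ∈ S.chains, grade ℕ C.head + grade ℕ C.last = posetRank P ∨
      grade ℕ C.head + grade ℕ C.last + 1 = posetRank P := by
    intro C hC
    obtain ⟨x, h0, h1, h2⟩ := S.exists_of_mem_chains hC
    have := h x
    omega
  refine ⟨S.isNCD_chains (posetRank P - 1) (fun C hC => by have := key C hC; omega),
    S.isCD_chains, fun C hC => ?_⟩
  rw [SaturatedChain.center]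
  refine (key C hC).imp (fun h => ?_) (fun h => ?_)
  · rw [← h]; push_cast; rfl
  · rw [← h]; push_cast; ring

theorem IsTopCentered.topHeavySeq [Finite P] {S : ChainSystem P} (h : S.IsTopCentered) :
    TopHeavySeq (rankSeq P) (posetRank P) := by
  intro k hk
  have := S.rankSeq_le_of_above (k := k) (j := posetRank P - 2 * k)
    (fun x hx => by have := h x; omega)
  rwa [show k + (posetRank P - 2 * k) = posetRank P - k by omega] at this

/-- An element of rank N − k has at least N − 2k − 1 elements below it on its chain. The loss of one
against the symmetric case is why the target rank is k + 1. -/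
theorem IsTopCentered.topInterlacingSeq [Finite P] {S : ChainSystem P} (h : S.IsTopCentered) :
    TopInterlacingSeq (rankSeq P) (posetRank P) := by
  refine ⟨h.topHeavySeq, fun k hk => ?_⟩
  have := S.rankSeq_le_of_below (k := k + 1) (j := posetRank P - 2 * k - 1)
    (fun x hx => by have := h x; omega)
  rwa [show k + 1 + (posetRank P - 2 * k - 1) = posetRank P - k by omega] at this

theorem IsSymmetric.symmetricSeq [Finite P] {S : ChainSystem P} (h : S.IsSymmetric) :
    SymmetricSeq (rankSeq P) (posetRank P) := by
  intro k hk
  apply le_antisymm (h.isTopCentered.topHeavySeq k hk)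
  have := S.rankSeq_le_of_below (k := k) (j := posetRank P - 2 * k)
    (fun x hx => by have := h x; omega)
  rwa [show k + (posetRank P - 2 * k) = posetRank P - k by omega] at this

end ChainSystem

/-! ### Bracketing of words

A word `c 0, c 1, …` with `a i ≤ c i ≤ s i` is read as the bracket sequence whose `i`th block
consists of `c i - a i` closing brackets followed by `s i - c i` opening brackets. -/

namespace Bracket

/-- The number of unmatched opening brackets in the first `k` blocks. -/
def opened (a s c : ℕ → ℕ) : ℕ → ℕ
  | 0 => 0
  | k + 1 => (opened a s c k - (c k - a k)) + (s k - c k)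

/-- The number of unmatched closing brackets in the first `k` blocks. -/
def closed (a s c : ℕ → ℕ) : ℕ → ℕ
  | 0 => 0
  | k + 1 => closed a s c k + ((c k - a k) - opened a s c k)

/-- The block of the first unmatched opening bracket. -/
def upIdx (a s c : ℕ → ℕ) : ℕ → ℕ
  | 0 => 0
  | k + 1 => if c k - a k < opened a s c k then upIdx a s c k else k

/-- The block of the last unmatched closing bracket. -/
def downIdx (a s c : ℕ → ℕ) : ℕ → ℕ
  | 0 => 0
  | k + 1 => if opened a s c k < c k - a k then k else downIdx a s c k

/-- Turn the first unmatched opening bracket into a closing one. -/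
def up (a s c : ℕ → ℕ) (k : ℕ) : ℕ → ℕ :=
  Function.update c (upIdx a s c k) (c (upIdx a s c k) + 1)

/-- Turn the last unmatched closing bracket into an opening one. -/
def down (a s c : ℕ → ℕ) (k : ℕ) : ℕ → ℕ :=
  Function.update c (downIdx a s c k) (c (downIdx a s c k) - 1)

variable {a s c c' : ℕ → ℕ} {k : ℕ}

theorem opened_congr (h : ∀ i < k, c i = c' i) : opened a s c k = opened a s c' k := by
  induction k with
  | zero => rfl
  | succ k ih => simp only [opened]; rw [ih (fun i hi => h i (by omega)), h k (by omega)]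

theorem closed_congr (h : ∀ i < k, c i = c' i) : closed a s c k = closed a s c' k := by
  induction k with
  | zero => rfl
  | succ k ih =>
    simp only [closed]
    rw [ih (fun i hi => h i (by omega)), opened_congr (fun i hi => h i (by omega)), h k (by omega)]

/-- Matched pairs cancel, so unmatched closing minus unmatched opening brackets equals all closing
minus all opening ones. This fixes the center of each chain. -/
theorem closed_add_sum (h : ∀ i < k, a i ≤ c i ∧ c i ≤ s i) :
    closed a s c k + ∑ i ∈ Finset.range k, (a i + s i) =
      opened a s c k + 2 * ∑ i ∈ Finset.range k, c i := by
  induction k with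
  | zero => rfl
  | succ k ih =>
    have := ih (fun i hi => h i (by omega))
    have := h k (by omega)
    simp only [closed, opened, Finset.sum_range_succ]
    omega

/-- The last inequality says that the closing brackets of the chosen block use up every bracket
opened earlier. -/
theorem upIdx_spec (h : opened a s c k ≠ 0) :
    upIdx a s c k < k ∧ c (upIdx a s c k) < s (upIdx a s c k) ∧
      opened a s c (upIdx a s c k) ≤ c (upIdx a s c k) - a (upIdx a s c k) := by
  induction k with
  | zero => exact absurd rfl h
  | succ k ih =>
    rw [opened] at h
    rw [upIdx]
    split_ifs with hc
    · obtain ⟨h1, h2⟩ := ih (by omega)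
      exact ⟨by omega, h2⟩
    · exact ⟨by omega, by omega, by omega⟩

/-- The last clause says that all closing brackets in later blocks are matched. -/
theorem downIdx_spec (h : closed a s c k ≠ 0) :
    downIdx a s c k < k ∧
      opened a s c (downIdx a s c k) < c (downIdx a s c k) - a (downIdx a s c k) ∧
      ∀ i < k, downIdx a s c k < i → c i - a i ≤ opened a s c i := by
  induction k with
  | zero => exact absurd rfl h
  | succ k ih =>
    rw [closed] at h
    rw [downIdx]
    split_ifs with hc
    · exact ⟨by omega, by omega, fun i h1 h2 => by omega⟩
    · obtain ⟨h1, h2, h3⟩ := ih (by omega)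
      refine ⟨by omega, h2, fun i h4 h5 => ?_⟩
      rcases Nat.lt_succ_iff_lt_or_eq.1 h4 with h6 | rfl
      · exact h3 i h6 h5
      · omega

/-- The unmatched brackets read `)…)(…(`. Flipping the first opening one leaves the matching intact
and makes it the last unmatched closing one, so `down` flips it back. -/
theorem up_spec (hb : ∀ i < k, a i ≤ c i) (h : opened a s c k ≠ 0) :
    opened a s (up a s c k) k + 1 = opened a s c k ∧
      closed a s (up a s c k) k = closed a s c k + 1 ∧
      downIdx a s (up a s c k) k = upIdx a s c k := by
  induction k with
  | zero => exact absurd rfl h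
  | succ k ih =>
    have hk := hb k (by omega)
    rw [opened] at h
    by_cases hc : c k - a k < opened a s c k
    · obtain ⟨h1, h2, h3⟩ := ih (fun i hi => hb i (by omega)) (by omega)
      have hlt := (upIdx_spec (k := k) (a := a) (s := s) (c := c) (by omega)).1
      have hup : up a s c (k + 1) = up a s c k := by simp only [up, upIdx, if_pos hc]
      have hval : up a s c k k = c k := by rw [up, Function.update_of_ne (by omega)]
      rw [hup, opened, closed, downIdx, hval, upIdx, if_pos hc, if_neg (by omega)]
      refine ⟨?_, ?_, h3⟩
      · rw [opened]; omega
      · rw [closed]; omega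
    -- Here block k closes everything opened before, so the flipped bracket lies in block k and the
    -- prefix is unchanged.
    · have hup : up a s c (k + 1) = Function.update c k (c k + 1) := by
        simp only [up, upIdx, if_neg hc]
      have hval : Function.update c k (c k + 1) k = c k + 1 := Function.update_self ..
      have hlow : ∀ i < k, Function.update c k (c k + 1) i = c i :=
        fun i hi => Function.update_of_ne (by omega) ..
      rw [hup, opened, closed, downIdx, hval, upIdx, if_neg hc, opened_congr hlow,
        closed_congr hlow, if_pos (by omega)]
      refine ⟨?_, ?_, rfl⟩
      · rw [opened]; omega
      · rw [closed]; omega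

theorem down_spec (hb : ∀ i < k, a i ≤ c i ∧ c i ≤ s i) (h : closed a s c k ≠ 0) :
    opened a s (down a s c k) k = opened a s c k + 1 ∧
      closed a s (down a s c k) k + 1 = closed a s c k ∧
      upIdx a s (down a s c k) k = downIdx a s c k := by
  induction k with
  | zero => exact absurd rfl h
  | succ k ih =>
    have hk := hb k (by omega)
    rw [closed] at h
    by_cases hc : opened a s c k < c k - a k
    · have hdn : down a s c (k + 1) = Function.update c k (c k - 1) := by
        simp only [down, downIdx, if_pos hc]
      have hval : Function.update c k (c k - 1) k = c k - 1 := Function.update_self ..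
      have hlow : ∀ i < k, Function.update c k (c k - 1) i = c i :=
        fun i hi => Function.update_of_ne (by omega) ..
      rw [hdn, opened, closed, downIdx, hval, upIdx, hval, if_pos hc, opened_congr hlow,
        closed_congr hlow, if_neg (by omega)]
      refine ⟨?_, ?_, rfl⟩
      · rw [opened]; omega
      · rw [closed]; omega
    · obtain ⟨h1, h2, h3⟩ := ih (fun i hi => hb i (by omega)) (by omega)
      have hlt := (downIdx_spec (k := k) (a := a) (s := s) (c := c) (by omega)).1
      have hdn : down a s c (k + 1) = down a s c k := by simp only [down, downIdx, if_neg hc]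
      have hval : down a s c k k = c k := by rw [down, Function.update_of_ne (by omega)]
      rw [hdn, opened, closed, upIdx, hval, downIdx, if_neg hc, if_pos (by omega)]
      refine ⟨?_, ?_, h3⟩
      · rw [opened]; omega
      · rw [closed]; omega

theorem down_up (hb : ∀ i < k, a i ≤ c i) (h : opened a s c k ≠ 0) :
    down a s (up a s c k) k = c := by
  rw [down, (up_spec hb h).2.2, up]
  simp

theorem up_down (hb : ∀ i < k, a i ≤ c i ∧ c i ≤ s i) (h : closed a s c k ≠ 0) :
    up a s (down a s c k) k = c := by
  have := (downIdx_spec h).2.1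
  rw [up, (down_spec hb h).2.2, down]
  simp only [Function.update_self, Function.update_idem]
  rw [Nat.sub_add_cancel (by omega), Function.update_eq_self]

end Bracket

/-! ### Words of order ideals of the divided poset -/

namespace DividedWord

open Bracket

/-- The sizes of the blocks: `q` blocks of size `d`, followed by a block of size `r`. -/
def size (d q r k : ℕ) : ℕ := if k < q then d else r

/-- The words which record the sizes of the intersections of an order ideal with the blocks. -/
structure IsWord (d q r : ℕ) (c : ℕ → ℕ) : Prop where
  le : ∀ k ≤ q, c k ≤ size d q r k
  zero : ∀ k, q < k → c k = 0
  ne_zero : ∀ k < q, c (k + 1) = size d q r (k + 1) → c k ≠ 0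

/-- The words whose last letter is matched completely in the preceding block. -/
def Special (d q r : ℕ) (c : ℕ → ℕ) : Prop := 0 < q ∧ c q = r ∧ c (q - 1) + r ≤ d

/-- The lower bounds of the letters of a special word, the last one omitted. -/
def specialLow (q k : ℕ) : ℕ := if k + 1 = q then 1 else 0

/-- The upper bounds of the letters of a special word, the last one omitted. -/
def specialHigh (d q r k : ℕ) : ℕ := if k + 1 = q then d - r else d

variable {d q r : ℕ} {c : ℕ → ℕ}

/-- The lower bound 1 at position q − 1 is admissibility, since the last block is full; the upper
bound d − r is specialness. -/
theorem Special.bounds (hw : IsWord d q r c) (hs : Special d q r c) :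
    ∀ i < q, specialLow q i ≤ c i ∧ c i ≤ specialHigh d q r i := by
  obtain ⟨hq, h1, h2⟩ := hs
  intro i hi
  have hle := hw.le i (by omega)
  have hne := hw.ne_zero i hi
  unfold specialLow specialHigh
  unfold size at hle hne
  rw [if_pos hi] at hle
  split_ifs with h
  · subst h
    rw [if_neg (by omega)] at hne
    have := hne h1
    rw [Nat.add_sub_cancel] at h2
    omega
  · omega

theorem IsWord.bounds (hw : IsWord d q r c) : ∀ i < q + 1, 0 ≤ c i ∧ c i ≤ size d q r i :=
  fun i hi => ⟨Nat.zero_le _, hw.le i (by omega)⟩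

/-- Raising a letter endangers admissibility only by filling a block right after an empty one. -/
theorem IsWord.update_succ (hw : IsWord d q r c) {j : ℕ} (hj : j ≤ q) (hlt : c j < size d q r j)
    (h : ∀ i, j = i + 1 → c j + 1 = size d q r j → c i ≠ 0) :
    IsWord d q r (Function.update c j (c j + 1)) where
  le k hk := by
    have := hw.le k hk
    rw [Function.update_apply]
    split_ifs with e
    · subst e; omega
    · exact this
  zero k hk := by
    rw [Function.update_of_ne (by omega)]
    exact hw.zero k hk
  ne_zero k hk := by
    intro hs
    rw [Function.update_apply] at hs ⊢
    split_ifs with e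
    · omega
    · split_ifs at hs with e'
      · exact h k e'.symm (e' ▸ hs)
      · exact hw.ne_zero k hk hs

/-- Lowering a letter endangers admissibility only by emptying a block right before a full one. -/
theorem IsWord.update_pred (hw : IsWord d q r c) {j : ℕ} (hj : j ≤ q) (hpos : 0 < c j)
    (h : j < q → c (j + 1) = size d q r (j + 1) → c j ≠ 1) :
    IsWord d q r (Function.update c j (c j - 1)) where
  le k hk := by
    have := hw.le k hk
    rw [Function.update_apply]
    split_ifs with e
    · subst e; omega
    · exact this
  zero k hk := by
    rw [Function.update_of_ne (by omega)]
    exact hw.zero k hk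
  ne_zero k hk := by
    intro hs
    rw [Function.update_apply] at hs ⊢
    split_ifs at hs with e'
    · have := hw.le (k + 1) hk
      subst e'
      omega
    · split_ifs with e
      · subst e
        have := h hk hs
        omega
      · exact hw.ne_zero k hk hs

/-! ### Bracket moves preserve admissibility and specialness -/

theorem le_opened {a s c : ℕ → ℕ} (k : ℕ) : s k - c k ≤ opened a s c (k + 1) := by
  rw [opened]; omega

/-- The opening brackets of the preceding block outnumber the closing ones of block j whenever the
move would fill j after an empty block, or make the word special by filling the last one. Then an
earlier bracket is still open after those closing ones, against the choice of j. -/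
theorem IsWord.up_of_not_special (hr : r ≤ d) (hw : IsWord d q r c) (hs : ¬ Special d q r c)
    (h : opened 0 (size d q r) c (q + 1) ≠ 0) :
    IsWord d q r (up 0 (size d q r) c (q + 1)) ∧
      ¬ Special d q r (up 0 (size d q r) c (q + 1)) := by
  obtain ⟨h1, h2, h3⟩ := upIdx_spec h
  rw [up]
  generalize upIdx 0 (size d q r) c (q + 1) = j at *
  simp only [Pi.zero_apply, Nat.sub_zero] at h3
  constructor
  · refine hw.update_succ (by omega) h2 ?_
    rintro i rfl hi h0
    have := le_opened (a := 0) (s := size d q r) (c := c) i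
    rw [h0, size, if_pos (by omega)] at this
    unfold size at *
    split_ifs at * <;> omega
  · rintro ⟨hq, e1, e2⟩
    rw [Function.update_apply] at e1 e2
    split_ifs at e1 e2 with f1 f2 f2
    · omega
    · subst f1
      have := le_opened (a := 0) (s := size d q r) (c := c) (q - 1)
      rw [Nat.sub_add_cancel hq, size, if_pos (by omega)] at this
      omega
    -- Lowering c_{q-1} back keeps the inequality, so the original word was special already.
    · exact hs ⟨hq, e1, by rw [f2]; omega⟩
    · exact hs ⟨hq, e1, e2⟩

theorem IsWord.down_of_not_special (hw : IsWord d q r c)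
    (hs : ¬ Special d q r c) (h : closed 0 (size d q r) c (q + 1) ≠ 0) :
    IsWord d q r (down 0 (size d q r) c (q + 1)) ∧
      ¬ Special d q r (down 0 (size d q r) c (q + 1)) := by
  obtain ⟨h1, h2, h3⟩ := downIdx_spec h
  rw [down]
  generalize downIdx 0 (size d q r) c (q + 1) = j at *
  simp only [Pi.zero_apply, Nat.sub_zero] at h2 h3
  -- Block j closes all earlier brackets, so exactly d − c_j are open after it; the closing brackets
  -- of the full block j + 1 are all matched, hence fit among these.
  have key : j < q → c (j + 1) = size d q r (j + 1) → c j + size d q r (j + 1) ≤ d := by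
    intro hj e
    have h4 := h3 (j + 1) (by omega) (by omega)
    have hle := hw.le j (by omega)
    rw [opened, e, Pi.zero_apply] at h4
    have : size d q r j = d := if_pos hj
    rw [this] at h4 hle
    omega
  have hlast : ∀ {i}, i + 1 = q → c q = r → d < c i + r := by
    intro i hi e
    by_contra hc
    exact hs ⟨by omega, e, by rw [← hi, Nat.add_sub_cancel]; omega⟩
  have hsq : size d q r q = r := if_neg (lt_irrefl _)
  constructor
  · refine hw.update_pred (by omega) (by omega) ?_
    intro hj e
    have h5 := key hj e
    by_cases hq : j + 1 = q
    · rw [hq, hsq] at e h5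
      have := hlast hq e
      omega
    -- Between blocks of size d, `key` forces c_j = 0, but block j has a closing bracket to flip.
    · have : size d q r (j + 1) = d := if_pos (by omega)
      omega
  · rintro ⟨hq, e1, e2⟩
    rw [Function.update_apply] at e1 e2
    have hle := hw.le q le_rfl
    rw [hsq] at hle
    split_ifs at e1 e2 with f1 f2 f2
    · omega
    · subst f1
      omega
    · have h5 := key (by omega) (by rw [show j + 1 = q by omega, e1, hsq])
      rw [show j + 1 = q by omega, hsq] at h5
      have := hlast (i := j) (by omega) e1
      omega
    · exact hs ⟨hq, e1, e2⟩

/-- The last letter is frozen, and block q − 1 cannot become full because its bound is d − r < d.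
Any other block is handled by the counting used for nonspecial words. -/
theorem IsWord.up_of_special (hr0 : 0 < r) (hr : r ≤ d) (hw : IsWord d q r c)
    (hs : Special d q r c) (h : opened (specialLow q) (specialHigh d q r) c q ≠ 0) :
    IsWord d q r (up (specialLow q) (specialHigh d q r) c q) ∧
      Special d q r (up (specialLow q) (specialHigh d q r) c q) := by
  obtain ⟨h1, h2, h3⟩ := upIdx_spec h
  rw [up]
  generalize upIdx (specialLow q) (specialHigh d q r) c q = j at *
  have hsj : size d q r j = d := if_pos h1
  constructor
  · refine hw.update_succ (by omega) ?_ ?_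
    · rw [hsj]
      unfold specialHigh at h2
      split_ifs at h2 <;> omega
    · rintro i rfl hi h0
      rw [hsj] at hi
      have := le_opened (a := specialLow q) (s := specialHigh d q r) (c := c) i
      unfold specialHigh at h2
      rw [h0, specialHigh, if_neg (by omega)] at this
      split_ifs at h2 <;> omega
  · obtain ⟨hq, e1, e2⟩ := hs
    refine ⟨hq, ?_, ?_⟩
    · rwa [Function.update_of_ne (by omega)]
    · rw [Function.update_apply]
      split_ifs with f
      · rw [specialHigh, if_pos (by omega)] at h2
        omega
      · exact e2

theorem IsWord.down_of_special (hr0 : 0 < r) (hw : IsWord d q r c)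
    (hs : Special d q r c) (h : closed (specialLow q) (specialHigh d q r) c q ≠ 0) :
    IsWord d q r (down (specialLow q) (specialHigh d q r) c q) ∧
      Special d q r (down (specialLow q) (specialHigh d q r) c q) := by
  obtain ⟨h1, h2, h3⟩ := downIdx_spec h
  rw [down]
  generalize downIdx (specialLow q) (specialHigh d q r) c q = j at *
  obtain ⟨hq, e1, e2⟩ := hs
  constructor
  · refine hw.update_pred (by omega) (by omega) ?_
    intro _ e hc
    by_cases hj : j + 1 = q
    · rw [specialLow, if_pos hj] at h2
      omega
    · have hsj : size d q r (j + 1) = d := if_pos (by omega)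
      rw [hsj] at e
      by_cases hj' : j + 1 + 1 = q
      -- Block q − 1 holds at most d − r < d elements, so it cannot be full.
      · rw [show q - 1 = j + 1 by omega] at e2
        omega
      · have h4 := h3 (j + 1) (by omega) (by omega)
        rw [opened, specialLow, specialLow, specialHigh, if_neg hj, if_neg hj', if_neg hj] at h4
        rw [specialLow, if_neg hj] at h2
        have hle := hw.le j (by omega)
        rw [size, if_pos h1] at hle
        omega
  · refine ⟨hq, ?_, ?_⟩
    · rwa [Function.update_of_ne (by omega)]
    · rw [Function.update_apply]
      split_ifs with f
      · rw [f] at e2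
        omega
      · exact e2

/-! ### The two bracketings glued into one move -/

open Classical in
/-- The number of words above a word on its chain. -/
noncomputable def above (d q r : ℕ) (c : ℕ → ℕ) : ℕ :=
  if Special d q r c then opened (specialLow q) (specialHigh d q r) c q
  else opened 0 (size d q r) c (q + 1)

open Classical in
/-- The number of words below a word on its chain. -/
noncomputable def below (d q r : ℕ) (c : ℕ → ℕ) : ℕ :=
  if Special d q r c then closed (specialLow q) (specialHigh d q r) c q
  else closed 0 (size d q r) c (q + 1)

open Classical in
/-- The next word on the chain. -/
noncomputable def next (d q r : ℕ) (c : ℕ → ℕ) : ℕ → ℕ :=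
  if Special d q r c then up (specialLow q) (specialHigh d q r) c q
  else up 0 (size d q r) c (q + 1)

open Classical in
/-- The previous word on the chain. -/
noncomputable def prev (d q r : ℕ) (c : ℕ → ℕ) : ℕ → ℕ :=
  if Special d q r c then down (specialLow q) (specialHigh d q r) c q
  else down 0 (size d q r) c (q + 1)

theorem IsWord.next_spec (hr0 : 0 < r) (hr : r ≤ d) (hw : IsWord d q r c)
    (h : above d q r c ≠ 0) :
    IsWord d q r (next d q r c) ∧ above d q r c = above d q r (next d q r c) + 1 ∧
      below d q r (next d q r c) = below d q r c + 1 ∧ prev d q r (next d q r c) = c ∧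
      ∃ j ≤ q, next d q r c = Function.update c j (c j + 1) := by
  by_cases hs : Special d q r c
  · rw [above, if_pos hs] at h
    obtain ⟨h1, h2⟩ := hw.up_of_special hr0 hr hs h
    have hb := fun i hi => (hs.bounds hw i hi).1
    obtain ⟨h3, h4, -⟩ := up_spec hb h
    rw [next, if_pos hs, above, if_pos hs, above, if_pos h2, below, if_pos h2, below, if_pos hs,
      prev, if_pos h2]
    exact ⟨h1, h3.symm, h4, down_up hb h, _, (upIdx_spec h).1.le, rfl⟩
  · rw [above, if_neg hs] at h
    obtain ⟨h1, h2⟩ := hw.up_of_not_special hr hs h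
    have hb := fun i hi => (hw.bounds i hi).1
    obtain ⟨h3, h4, -⟩ := up_spec (a := 0) hb h
    rw [next, if_neg hs, above, if_neg hs, above, if_neg h2, below, if_neg h2, below, if_neg hs,
      prev, if_neg h2]
    exact ⟨h1, h3.symm, h4, down_up hb h, _, Nat.lt_succ_iff.1 (upIdx_spec h).1, rfl⟩

theorem IsWord.prev_spec (hr0 : 0 < r) (hw : IsWord d q r c)
    (h : below d q r c ≠ 0) :
    IsWord d q r (prev d q r c) ∧ above d q r (prev d q r c) ≠ 0 ∧
      next d q r (prev d q r c) = c := by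
  by_cases hs : Special d q r c
  · rw [below, if_pos hs] at h
    obtain ⟨h1, h2⟩ := hw.down_of_special hr0 hs h
    obtain ⟨h3, -, -⟩ := down_spec (hs.bounds hw) h
    rw [prev, if_pos hs, above, if_pos h2, next, if_pos h2]
    exact ⟨h1, by omega, up_down (hs.bounds hw) h⟩
  · rw [below, if_neg hs] at h
    obtain ⟨h1, h2⟩ := hw.down_of_not_special hs h
    obtain ⟨h3, -, -⟩ := down_spec (a := 0) hw.bounds h
    rw [prev, if_neg hs, above, if_neg h2, next, if_neg h2]
    exact ⟨h1, by omega, up_down (a := 0) hw.bounds h⟩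

/-- For special words the bounds of the first q letters sum to (q − 1)d + 1 + (d − r), and the
frozen letter adds 2r to the doubled rank: qd + r + 1 in total. Otherwise the bounds sum to qd + r.
The bounds 1 ≤ c_{q-1} ≤ d − r force r < d. -/
theorem IsWord.center (hw : IsWord d q r c) :
    2 * ∑ k ∈ Finset.range (q + 1), c k + above d q r c = q * d + r + below d q r c ∨
      0 < q ∧ r < d ∧
        2 * ∑ k ∈ Finset.range (q + 1), c k + above d q r c = q * d + r + 1 + below d q r c := by
  by_cases hs : Special d q r c
  · right
    have h := closed_add_sum (hs.bounds hw)
    have hb := hs.bounds hw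
    rw [above, below, if_pos hs, if_pos hs]
    obtain ⟨hq, e1, e2⟩ := hs
    obtain ⟨m, rfl⟩ : ∃ m, q = m + 1 := ⟨q - 1, by omega⟩
    rw [Finset.sum_range_succ, Finset.sum_congr rfl (g := fun _ => d)] at h
    · rw [Finset.sum_const, Finset.card_range, smul_eq_mul, specialLow, if_pos rfl, specialHigh,
        if_pos rfl] at h
      have := hb m (by omega)
      rw [specialLow, if_pos rfl, specialHigh, if_pos rfl] at this
      rw [Finset.sum_range_succ _ (m + 1), e1, add_mul, one_mul]
      refine ⟨hq, by omega, by omega⟩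
    · intro k hk
      rw [Finset.mem_range] at hk
      rw [specialLow, specialHigh, if_neg (by omega), if_neg (by omega), zero_add]
  · left
    have h := closed_add_sum (a := 0) hw.bounds
    rw [above, below, if_neg hs, if_neg hs]
    rw [Finset.sum_range_succ, Finset.sum_congr rfl (g := fun _ => d)] at h
    · rw [Finset.sum_const, Finset.card_range, smul_eq_mul, size, if_neg (lt_irrefl _)] at h
      simp only [Pi.zero_apply] at h
      omega
    · intro k hk
      rw [size, if_pos (Finset.mem_range.1 hk), Pi.zero_apply, zero_add]

end DividedWord

/-! ### Order ideals of the divided poset -/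

theorem posetRank_lowerSet {P : Type*} [PartialOrder P] [Finite P] :
    posetRank (LowerSet P) = Nat.card P := by
  have h : ∀ I : LowerSet P, grade ℕ I ≤ Nat.card P := fun I => Set.ncard_le_card _
  apply le_antisymm (ciSup_le h)
  refine le_trans ?_ (le_ciSup ⟨Nat.card P, by rintro _ ⟨I, rfl⟩; exact h I⟩ ⊤)
  change _ ≤ Set.ncard ((⊤ : LowerSet P) : Set P)
  simp

namespace DDivided

open DividedWord

variable {n d q r : ℕ}

/-- The element of the divided poset with label `x + 1`. -/
def ofFin (d : ℕ) (x : Fin n) : DDivided n d := x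

/-- The element with label `y + 1` lies in the order ideal `I`. -/
def MemIdx (I : LowerSet (DDivided n d)) (y : ℕ) : Prop :=
  ∃ h : y < n, ofFin d ⟨y, h⟩ ∈ I

theorem le_of_cover {x y : DDivided n d} (h : DDividedCover n d x.label y.label) : x ≤ y :=
  Relation.ReflTransGen.single h

theorem memIdx_of_cover {I : LowerSet (DDivided n d)} {x y : ℕ} (hx : x < n) (hy : MemIdx I y)
    (h : DDividedCover n d (x + 1) (y + 1)) : MemIdx I x := by
  obtain ⟨hyn, hy⟩ := hy
  exact ⟨hx, I.lower (le_of_cover (x := ofFin d ⟨x, hx⟩) (y := ofFin d ⟨y, hyn⟩) h) hy⟩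

theorem memIdx_of_le {I : LowerSet (DDivided n d)} {k i j : ℕ} (hj : j < d)
    (hI : MemIdx I (k * d + j)) (hij : i ≤ j) : MemIdx I (k * d + i) := by
  induction j, hij using Nat.le_induction with
  | base => exact hI
  | succ j hij ih =>
    have := hI.1
    refine ih (by omega) (memIdx_of_cover (by omega) hI (Or.inl ⟨rfl, ?_⟩))
    rw [add_assoc, Nat.dvd_add_right (Dvd.intro_left k rfl)]
    exact Nat.not_dvd_of_pos_of_lt (by omega) hj

/-- The sizes of the intersections of an order ideal with the blocks. -/
noncomputable def word (I : LowerSet (DDivided n d)) (k : ℕ) : ℕ :=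
  sInf {i | ¬ (i < d ∧ MemIdx I (k * d + i))}

/-- A block is a chain, so the ideal meets it in an initial segment and the first missing offset is
the size of the intersection. -/
theorem lt_word {I : LowerSet (DDivided n d)} {k i : ℕ} :
    i < word I k ↔ i < d ∧ MemIdx I (k * d + i) := by
  constructor
  · intro h
    by_contra hc
    exact absurd h (not_lt.2 (Nat.sInf_le hc))
  · rintro ⟨h1, h2⟩
    by_contra hc
    have hmem : word I k ∈ {i | ¬ (i < d ∧ MemIdx I (k * d + i))} :=
      Nat.sInf_mem ⟨d, fun h => lt_irrefl d h.1⟩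
    exact hmem ⟨by omega, memIdx_of_le h1 h2 (not_lt.1 hc)⟩

theorem mem_iff_lt_word (hd : 0 < d) {I : LowerSet (DDivided n d)} {x : Fin n} :
    ofFin d x ∈ I ↔ x.val % d < word I (x.val / d) := by
  rw [lt_word, Nat.div_add_mod']
  exact ⟨fun h => ⟨Nat.mod_lt _ hd, x.2, h⟩, fun h => h.2.2⟩

theorem word_injective (hd : 0 < d) :
    Function.Injective (word : LowerSet (DDivided n d) → ℕ → ℕ) := by
  intro I J h
  ext x
  exact (mem_iff_lt_word hd).trans (by rw [h]; exact (mem_iff_lt_word hd).symm)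

theorem le_of_word_le (hd : 0 < d) {I J : LowerSet (DDivided n d)} (h : word I ≤ word J) :
    I ≤ J :=
  fun _ hx => (mem_iff_lt_word hd).2 (((mem_iff_lt_word hd).1 hx).trans_le (h _))

/-- The last condition reflects the covers between blocks: the top of block k + 1 lies above the
bottom of block k. -/
theorem isWord_word (hr0 : 0 < r) (hr : r ≤ d) (hn : n = q * d + r)
    (I : LowerSet (DDivided n d)) : IsWord d q r (word I) where
  le k hk := by
    by_contra! hc
    obtain ⟨h1, h2, -⟩ := lt_word.1 hc
    unfold size at h1 h2
    split_ifs at h1 h2 with h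
    · omega
    · rw [show k = q by omega] at h2
      omega
  zero k hk := by
    by_contra hc
    obtain ⟨-, h2, -⟩ := lt_word.1 (Nat.pos_of_ne_zero hc)
    have := Nat.mul_le_mul_right d hk
    rw [Nat.succ_mul] at this
    omega
  ne_zero k hk := by
    intro h
    have hs : 0 < size d q r (k + 1) := by unfold size; split_ifs <;> omega
    have hI := (lt_word.1 (show size d q r (k + 1) - 1 < word I (k + 1) by omega)).2
    have hkq := Nat.mul_le_mul_right d (show k + 1 ≤ q from hk)
    apply Nat.pos_iff_ne_zero.1
    refine lt_word.2 ⟨by omega, memIdx_of_cover (by rw [Nat.succ_mul] at hkq; omega) hI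
      (Or.inr ⟨k, rfl, by omega, ?_⟩)⟩
    unfold size at *
    rw [show (k + 2) * d = (k + 1) * d + d by ring]
    split_ifs with h'
    · have := Nat.mul_le_mul_right d (show k + 1 + 1 ≤ q from h')
      rw [Nat.succ_mul] at this
      rw [min_eq_left (by omega)]
      omega
    · rw [show k + 1 = q by omega, min_eq_right (by omega)]
      omega

/-- The order ideal with a given word. -/
def ofWord (hr : r ≤ d) (hn : n = q * d + r) {c : ℕ → ℕ}
    (hc : IsWord d q r c) : LowerSet (DDivided n d) where
  carrier := {x | Fin.val (n := n) x % d < c (Fin.val (n := n) x / d)}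
  lower' := by
    intro y x hxy hy
    induction hxy with
    | refl => exact hy
    | @tail z w hz hzy ih =>
      apply ih
      clear ih hz
      obtain ⟨z, hz⟩ : Fin n := z
      obtain ⟨w, hw⟩ : Fin n := w
      have hd : 0 < d := by
        rcases Nat.eq_zero_or_pos d with rfl | h
        · omega
        · exact h
      change w % d < c (w / d) at hy
      change z % d < c (z / d)
      change DDividedCover n d (z + 1) (w + 1) at hzy
      rcases hzy with ⟨h1, h2⟩ | ⟨k, h1, h2, h3⟩
      · obtain rfl : w = z + 1 := by omega
        rw [Nat.succ_div_of_not_dvd h2] at hy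
        have := Nat.add_mod_of_add_mod_lt (a := z) (b := 1) (c := d) (by
          have := Nat.mod_lt z hd
          rcases Nat.lt_or_ge 1 d with h | h
          · rw [Nat.mod_eq_of_lt h]
            by_contra hge
            apply h2
            have : z % d + 1 = d := by omega
            have h4 := Nat.div_add_mod z d
            exact ⟨z / d + 1, by rw [mul_add]; omega⟩
          · exact absurd (by rw [show d = 1 by omega]; exact one_dvd _) h2)
        omega
      · obtain rfl : z = k * d := by omega
        rw [Nat.mul_mod_left, Nat.mul_div_cancel _ hd]
        have hkq : k < q := by
          by_contra hge
          have := Nat.mul_le_mul_right d (show q ≤ k by omega)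
          rw [Nat.succ_mul] at h2
          omega
        refine Nat.pos_of_ne_zero (hc.ne_zero k hkq ?_)
        -- Here s is the size of block k + 1 (d, or r for the last block) and w is its top, at
        -- offset s − 1; its membership makes the letter full.
        obtain ⟨s, hs0, hsd, hws, hs⟩ : ∃ s, 0 < s ∧ s ≤ d ∧ w + 1 = (k + 1) * d + s ∧
            s = size d q r (k + 1) := by
          rw [show (k + 2) * d = (k + 1) * d + d by ring] at h3
          by_cases h' : k + 1 < q
          · have := Nat.mul_le_mul_right d (show k + 1 + 1 ≤ q from h')
            rw [Nat.succ_mul] at this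
            exact ⟨d, hd, le_rfl, by omega, (if_pos h').symm⟩
          · have hk : k + 1 = q := by omega
            rw [hk] at h2 h3 ⊢
            exact ⟨r, by omega, hr, by omega, (if_neg (lt_irrefl _)).symm⟩
        have hdiv : w / d = k + 1 := by
          rw [show w = (s - 1) + d * (k + 1) by rw [mul_comm]; omega,
            Nat.add_mul_div_left _ _ hd, Nat.div_eq_of_lt (by omega), zero_add]
        have hmod : w % d = s - 1 := by
          rw [show w = (s - 1) + d * (k + 1) by rw [mul_comm]; omega,
            Nat.add_mul_mod_self_left, Nat.mod_eq_of_lt (by omega)]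
        rw [hdiv, hmod] at hy
        have := hc.le (k + 1) hkq
        omega

theorem word_ofWord (hr0 : 0 < r) (hr : r ≤ d) (hn : n = q * d + r) {c : ℕ → ℕ}
    (hc : IsWord d q r c) : word (ofWord hr hn hc) = c := by
  have hd : 0 < d := by omega
  funext k
  refine eq_of_forall_lt_iff fun i => ?_
  have key : i < d → ((k * d + i) % d = i ∧ (k * d + i) / d = k) := by
    intro hi
    rw [Nat.mul_add_mod_of_lt hi, mul_comm, Nat.mul_add_div hd, Nat.div_eq_of_lt hi]
    simp
  rw [lt_word]
  constructor
  · rintro ⟨h1, h2, h3⟩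
    change (k * d + i) % d < c ((k * d + i) / d) at h3
    rwa [(key h1).1, (key h1).2] at h3
  · intro h
    have hkq : k ≤ q := by
      by_contra hk
      rw [hc.zero k (by omega)] at h
      omega
    have hle := hc.le k hkq
    have hb : i < d ∧ k * d + i < n := by
      unfold size at hle
      split_ifs at hle with h'
      · have := Nat.mul_le_mul_right d (show k + 1 ≤ q from h')
        rw [Nat.succ_mul] at this
        omega
      · obtain rfl : k = q := by omega
        omega
    refine ⟨hb.1, hb.2, ?_⟩
    change (k * d + i) % d < c ((k * d + i) / d)
    rwa [(key hb.1).1, (key hb.1).2]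

theorem grade_eq_sum_word (hr0 : 0 < r) (hr : r ≤ d) (hn : n = q * d + r)
    (I : LowerSet (DDivided n d)) :
    grade ℕ I = ∑ k ∈ Finset.range (q + 1), word I k := by
  classical
  have hd : 0 < d := by omega
  let A : Finset (Fin n) := Finset.univ.filter fun x => ofFin d x ∈ I
  have hA : grade ℕ I = A.card := by
    change Set.ncard ((I : Set (DDivided n d)) : Set (Fin n)) = _
    rw [← Set.ncard_coe_finset]
    congr 1
    ext x
    simp only [A, Finset.coe_filter, Finset.mem_univ, true_and]
    rfl
  rw [hA, Finset.card_eq_sum_card_fiberwise (f := fun x => x.val / d)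
    (t := Finset.range (q + 1))]
  · refine Finset.sum_congr rfl fun k _ => ?_
    rw [← Finset.card_range (word I k)]
    refine Finset.card_bij (fun x _ => x.val % d) ?_ ?_ ?_
    · intro x hx
      simp only [A, Finset.mem_filter, Finset.mem_univ, true_and, mem_iff_lt_word hd] at hx
      rw [Finset.mem_range, ← hx.2]
      exact hx.1
    · intro x hx y hy hxy
      simp only [Finset.mem_filter] at hx hy
      rw [Fin.ext_iff, ← Nat.div_add_mod x.val d, ← Nat.div_add_mod y.val d, hx.2, hy.2, hxy]
    · intro i hi
      obtain ⟨hid, hlt, hmem⟩ := lt_word.1 (Finset.mem_range.1 hi)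
      refine ⟨⟨k * d + i, hlt⟩, ?_, ?_⟩
      · simp only [A, Finset.mem_filter, Finset.mem_univ, true_and]
        refine ⟨hmem, ?_⟩
        rw [mul_comm, Nat.mul_add_div hd, Nat.div_eq_of_lt hid, add_zero]
      · change (k * d + i) % d = i
        exact Nat.mul_add_mod_of_lt hid
  · intro x _
    simp only [Finset.coe_range, Set.mem_Iio]
    rw [Nat.div_lt_iff_lt_mul hd, Nat.succ_mul]
    have := x.2
    omega

/-- The chains of order ideals of the divided poset obtained from bracketing their words. -/
noncomputable def chainSystem (hr0 : 0 < r) (hr : r ≤ d) (hn : n = q * d + r) :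
    ChainSystem (LowerSet (DDivided n d)) where
  step I J := DividedWord.above d q r (word I) ≠ 0 ∧ word J = DividedWord.next d q r (word I)
  above I := DividedWord.above d q r (word I)
  below I := DividedWord.below d q r (word I)
  covBy := by
    rintro I J ⟨h, hJ⟩
    obtain ⟨-, -, -, -, j, hj, hup⟩ := (isWord_word hr0 hr hn I).next_spec hr0 hr h
    rw [hup] at hJ
    have hle : I ≤ J := le_of_word_le (by omega) (by rw [hJ, le_update_self_iff]; omega)
    have hgr : grade ℕ J = grade ℕ I + 1 := by
      rw [grade_eq_sum_word hr0 hr hn, grade_eq_sum_word hr0 hr hn, hJ,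
        Finset.sum_update_of_mem (Finset.mem_range.2 (by omega)),
        ← Finset.add_sum_erase _ (word I) (Finset.mem_range.2 (show j < q + 1 by omega)),
        Finset.sdiff_singleton_eq_erase]
      omega
    -- The ranks differ by one, so no ideal fits strictly between.
    refine ⟨lt_of_le_of_ne hle (fun e => by rw [e] at hgr; omega), fun K h1 h2 => ?_⟩
    have := grade_strictMono (𝕆 := ℕ) h1
    have := grade_strictMono (𝕆 := ℕ) h2
    omega
  above_eq := by
    rintro I J ⟨h, hJ⟩
    rw [hJ]
    exact ((isWord_word hr0 hr hn I).next_spec hr0 hr h).2.1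
  below_eq := by
    rintro I J ⟨h, hJ⟩
    rw [hJ]
    exact ((isWord_word hr0 hr hn I).next_spec hr0 hr h).2.2.1
  exists_next {I} h :=
    ⟨ofWord hr hn ((isWord_word hr0 hr hn I).next_spec hr0 hr h).1, h, word_ofWord hr0 _ _ _⟩
  exists_prev {J} h := by
    obtain ⟨h1, h2, h3⟩ := (isWord_word hr0 hr hn J).prev_spec hr0 h
    refine ⟨ofWord hr hn h1, ?_, ?_⟩
    · rwa [word_ofWord hr0]
    · rw [word_ofWord hr0, h3]
  next_unique := by
    rintro I J K ⟨_, h1⟩ ⟨_, h2⟩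
    exact word_injective (by omega) (h1.trans h2.symm)
  prev_unique := by
    rintro I J K ⟨h1, h2⟩ ⟨h3, h4⟩
    apply word_injective (by omega)
    rw [← ((isWord_word hr0 hr hn I).next_spec hr0 hr h1).2.2.2.1,
      ← ((isWord_word hr0 hr hn J).next_spec hr0 hr h3).2.2.2.1, ← h2, h4]

theorem posetRank_eq : posetRank (LowerSet (DDivided n d)) = n := by
  rw [posetRank_lowerSet]
  exact Nat.card_fin n

theorem chainSystem_isTopCentered (hr0 : 0 < r) (hr : r ≤ d) (hn : n = q * d + r) :
    (chainSystem hr0 hr hn).IsTopCentered := by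
  intro I
  have := (isWord_word hr0 hr hn I).center
  rw [← grade_eq_sum_word hr0 hr hn, ← hn] at this
  rw [posetRank_eq]
  exact this.imp_right fun h => h.2.2

theorem chainSystem_isSymmetric (hr0 : 0 < r) (hr : r ≤ d) (hn : n = q * d + r)
    (h : q = 0 ∨ r = d) : (chainSystem hr0 hr hn).IsSymmetric := by
  intro I
  have := (isWord_word hr0 hr hn I).center
  rw [← grade_eq_sum_word hr0 hr hn, ← hn] at this
  rw [posetRank_eq]
  refine this.resolve_right fun h' => ?_
  omega

end DDivided

/-! ### Duality -/

section Duality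

variable {P Q : Type*} [PartialOrder P] [PartialOrder Q]

/-- Complementation identifies the order ideals of a poset with those of the dual poset, in
reverse order. -/
def LowerSet.complIso (e : Pᵒᵈ ≃o Q) : LowerSet Q ≃o (LowerSet P)ᵒᵈ where
  toFun I := OrderDual.toDual
    ⟨{x | e (OrderDual.toDual x) ∉ I}, fun _ _ h ha hb =>
      ha (I.lower (e.monotone (OrderDual.toDual_le_toDual.2 h)) hb)⟩
  invFun J :=
    ⟨{y | OrderDual.ofDual (e.symm y) ∉ OrderDual.ofDual J}, fun _ _ h ha hb =>
      ha ((OrderDual.ofDual J).lower (OrderDual.ofDual_le_ofDual.2 (e.symm.monotone h)) hb)⟩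
  left_inv I := by
    ext y
    change ¬ (e (OrderDual.toDual (OrderDual.ofDual (e.symm y))) ∉ I) ↔ y ∈ I
    simp
  right_inv J := by
    apply OrderDual.ofDual.injective
    ext x
    change ¬ (OrderDual.ofDual (e.symm (e (OrderDual.toDual x))) ∉ OrderDual.ofDual J) ↔ _
    simp
  map_rel_iff' {I J} := by
    constructor
    · intro h y hy
      by_contra hc
      have hm : ¬ (e (OrderDual.toDual (OrderDual.ofDual (e.symm y))) ∈ J) := by simpa using hc
      have := (show ∀ x, e (OrderDual.toDual x) ∉ J → e (OrderDual.toDual x) ∉ I from h) _ hm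
      simp at this
      exact this hy
    · intro h x hx hxI
      exact hx (h hxI)

theorem LowerSet.grade_add_grade_complIso [Finite P] [Finite Q] (e : Pᵒᵈ ≃o Q) (I : LowerSet Q) :
    grade ℕ I + grade ℕ (OrderDual.ofDual (LowerSet.complIso e I)) = Nat.card Q := by
  rw [← Set.ncard_add_ncard_compl (I : Set Q)]
  change _ + Set.ncard {x : P | e (OrderDual.toDual x) ∉ I} = _
  congr 1
  rw [← Set.ncard_image_of_injective _ (e.injective.comp OrderDual.toDual.injective)]
  congr 1
  ext y
  constructor
  · rintro ⟨x, hx, rfl⟩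
    exact hx
  · intro hy
    refine ⟨OrderDual.ofDual (e.symm y), ?_, by simp⟩
    change ¬ (e (OrderDual.toDual (OrderDual.ofDual (e.symm y))) ∈ I)
    simpa using hy

theorem natCard_eq_of_dualIso (e : Pᵒᵈ ≃o Q) : Nat.card P = Nat.card Q :=
  Nat.card_congr (OrderDual.toDual.trans e.toEquiv)

/-- Complementation exchanges rank k with N − k and above with below, so an end sum N + 1 becomes N
− 1. -/
theorem ChainSystem.IsTopCentered.dual [Finite P] [Finite Q] {S : ChainSystem (LowerSet P)}
    (h : S.IsTopCentered) (e : Pᵒᵈ ≃o Q) : (S.dual (LowerSet.complIso e)).IsBottomCentered := by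
  intro I
  have h1 := LowerSet.grade_add_grade_complIso e I
  have h2 := h (OrderDual.ofDual (LowerSet.complIso e I))
  rw [posetRank_lowerSet, natCard_eq_of_dualIso e] at h2
  rw [posetRank_lowerSet]
  simp only [ChainSystem.dual]
  omega

theorem ChainSystem.IsSymmetric.dual [Finite P] [Finite Q] {S : ChainSystem (LowerSet P)}
    (h : S.IsSymmetric) (e : Pᵒᵈ ≃o Q) : (S.dual (LowerSet.complIso e)).IsSymmetric := by
  intro I
  have h1 := LowerSet.grade_add_grade_complIso e I
  have h2 := h (OrderDual.ofDual (LowerSet.complIso e I))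
  rw [posetRank_lowerSet, natCard_eq_of_dualIso e] at h2
  rw [posetRank_lowerSet]
  simp only [ChainSystem.dual]
  omega

/-- Complementing and then applying the duality matches ideals of size k with ideals of size N − k.
-/
theorem symmetricSeq_of_selfDual [Finite P] (e : Pᵒᵈ ≃o P) :
    SymmetricSeq (rankSeq (LowerSet P)) (Nat.card P) := by
  intro k hk
  let f : LowerSet P → LowerSet P := fun I => OrderDual.ofDual (LowerSet.complIso e I)
  have hf : f.Injective := OrderDual.ofDual.injective.comp (LowerSet.complIso e).injective
  rw [rankSeq, rankSeq, ← Set.ncard_image_of_injective _ hf]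
  congr 1
  ext J
  constructor
  · rintro ⟨I, hI, rfl⟩
    have := LowerSet.grade_add_grade_complIso e I
    have hI : grade ℕ I = k := hI
    change grade ℕ (OrderDual.ofDual (LowerSet.complIso e I)) = _
    omega
  · intro hJ
    have hJ : grade ℕ J = Nat.card P - k := hJ
    have := LowerSet.grade_add_grade_complIso e ((LowerSet.complIso e).symm (OrderDual.toDual J))
    rw [OrderIso.apply_symm_apply, OrderDual.ofDual_toDual] at this
    refine ⟨(LowerSet.complIso e).symm (OrderDual.toDual J), ?_, by simp [f]⟩
    change grade ℕ _ = k
    omega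

/-- Divided posets and fences are both ordered by generated relations, so a duality need only be
checked on generators. -/
theorem reflTransGen_apply_iff_swap {V W : Type*} {R : V → V → Prop} {R' : W → W → Prop}
    (e : V ≃ W) (he : ∀ a b, R' (e a) (e b) ↔ R b a) {a b : V} :
    Relation.ReflTransGen R' (e a) (e b) ↔ Relation.ReflTransGen R b a := by
  constructor
  · intro h
    have := Relation.ReflTransGen.lift (p := Function.swap R) e.symm
      (fun x y hxy => (he _ _).1 (by simpa using hxy)) _ _ h
    rw [← Relation.reflTransGen_swap]
    simpa [Function.onFun] using this
  · intro h
    exact Relation.ReflTransGen.lift (r := Function.swap R) e (fun x y hxy => (he x y).2 hxy) _ _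
      (Relation.reflTransGen_swap.2 h)

end Duality

/-! ### Fences -/

namespace Fence

theorem natCard {m : ℕ} (α : Composition m) : Nat.card (Fence α) = m + 1 := Nat.card_fin _

/-- A fence is self-dual if its path reads the same, up to reversing the steps, from both ends. -/
def selfDualIso {m : ℕ} (α : Composition m)
    (h : ∀ i < m, StepUp α.blocks (m - 1 - i) ↔ StepUp α.blocks i) : (Fence α)ᵒᵈ ≃o Fence α where
  toEquiv := OrderDual.ofDual.trans (Fin.revPerm (n := m + 1))
  map_rel_iff' {a b} := by
    refine reflTransGen_apply_iff_swap (V := Fence α) (W := Fence α)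
      (R := fun x y => FenceCover α.blocks x.pos y.pos) (Fin.revPerm (n := m + 1)) ?_
    intro x y
    have hx : x.pos < m + 1 := Fin.is_lt (n := m + 1) x
    have hy : y.pos < m + 1 := Fin.is_lt (n := m + 1) y
    change FenceCover α.blocks (m + 1 - (x.pos + 1)) (m + 1 - (y.pos + 1)) ↔
      FenceCover α.blocks y.pos x.pos
    refine or_congr ?_ ?_
    · constructor
      · rintro ⟨h1, h2⟩
        exact ⟨by omega, (h _ (by omega)).1 (by convert h2 using 1; omega)⟩
      · rintro ⟨h1, h2⟩
        exact ⟨by omega, by have := (h _ (by omega)).2 h2; convert this using 1; omega⟩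
    · constructor
      · rintro ⟨h1, h2⟩
        exact ⟨by omega, fun h3 => h2 (by have := (h _ (by omega)).2 h3; convert this using 1; omega)⟩
      · rintro ⟨h1, h2⟩
        exact ⟨by omega, fun h3 => h2 ((h _ (by omega)).1 (by convert h3 using 1; omega))⟩

theorem symmetricSeq {m : ℕ} (α : Composition m)
    (h : ∀ i < m, StepUp α.blocks (m - 1 - i) ↔ StepUp α.blocks i) :
    SymmetricSeq (fenceRankSeq α) (m + 1) := by
  rw [← natCard α]
  exact symmetricSeq_of_selfDual (selfDualIso α h)

end Fence

/-- When the outer parts agree, r(α′) may satisfy several of the three conditions at once; a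
symmetric decomposition serves every branch, being also top and bottom centered. -/
theorem centeredConjectureHolds_of_chainSystem {m : ℕ} (α : Composition m)
    (S : ChainSystem (LowerSet (Fence α))) (hS : S.IsBottomCentered)
    (h1 : α.length = 1 → S.IsSymmetric)
    (h3 : 3 ≤ α.length → Odd α.length → α.blocks.getLastD 0 ≤ α.blocks.headD 0 ∧
      (α.blocks.headD 0 = α.blocks.getLastD 0 → S.IsSymmetric ∧
        SymmetricSeq (fenceRankSeq (innerComposition α)) (α.blocks.tail.dropLast.sum + 1))) :
    CenteredConjectureHolds α := by
  refine ⟨fun h => ⟨_, (h1 h).isNCD.2⟩, fun _ => ⟨_, hS.isNCD.2⟩, fun hl ho => ?_⟩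
  obtain ⟨h4, h5⟩ := h3 hl ho
  refine ⟨fun _ => ⟨_, hS.isNCD.2⟩, fun h => absurd h (not_lt.2 h4), fun h => ?_⟩
  obtain ⟨h6, h7⟩ := h5 h
  exact ⟨Or.inl h7, fun _ => ⟨_, h6.isNCD.2⟩, fun _ => ⟨_, h6.isBottomCentered.isNCD.2⟩,
    fun _ => ⟨_, h6.isTopCentered.isNCD.2⟩⟩

/-! ### The fence of the dual of the divided poset -/

namespace DDivided

variable {n d q r : ℕ}

/-- The parts `(d - 1, 1, d - 1, 1, …, d - 1, 1, r - 1)`, the last of which is omitted if it is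
zero. -/
def fenceParts (d r : ℕ) : ℕ → List ℕ
  | 0 => if r = 1 then [] else [r - 1]
  | q + 1 => (d - 1) :: 1 :: fenceParts d r q

/-- The parts `(1, d - 1, 1, …, d - 1, 1)`. -/
def innerParts (d : ℕ) : ℕ → List ℕ
  | 0 => [1]
  | q + 1 => 1 :: (d - 1) :: innerParts d q

/-- Isolates the outer parts, so that the inner composition can be read off. -/
theorem fenceParts_succ (d r q : ℕ) :
    fenceParts d r (q + 1) = (d - 1) :: (innerParts d q ++ fenceParts d r 0) := by
  induction q with
  | zero => rfl
  | succ q ih =>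
    change (d - 1) :: 1 :: fenceParts d r (q + 1) = _
    rw [ih]
    rfl

theorem length_innerParts (d q : ℕ) : (innerParts d q).length = 2 * q + 1 := by
  induction q with
  | zero => rfl
  | succ q ih => simp only [innerParts, List.length_cons, ih]; omega

theorem sum_innerParts (hd : 0 < d) (q : ℕ) : (innerParts d q).sum = q * d + 1 := by
  induction q with
  | zero => simp [innerParts]
  | succ q ih =>
    simp only [innerParts, List.sum_cons, ih, Nat.succ_mul]
    omega

theorem sum_fenceParts (hd : 0 < d) (hr : 0 < r) (q : ℕ) :
    (fenceParts d r q).sum = q * d + r - 1 := by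
  induction q with
  | zero => rw [fenceParts]; split_ifs with h <;> simp [h]
  | succ q ih =>
    simp only [fenceParts, List.sum_cons, ih, Nat.succ_mul]
    omega

theorem pos_of_mem_fenceParts (hd : q = 0 ∨ 1 < d) (hr : 0 < r) {i : ℕ}
    (hi : i ∈ fenceParts d r q) : 0 < i := by
  induction q with
  | zero =>
    rw [fenceParts] at hi
    split_ifs at hi with h
    · simp at hi
    · rw [List.mem_singleton] at hi
      omega
  | succ q ih =>
    simp only [fenceParts, List.mem_cons] at hi
    rcases hi with rfl | rfl | hi
    · omega
    · exact one_pos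
    · exact ih (by omega) hi

theorem stepUp_cons_cons {a b : ℕ} {l : List ℕ} {i : ℕ} :
    StepUp (a :: b :: l) i ↔ i < a ∨ (a + b ≤ i ∧ StepUp l (i - (a + b))) := by
  simp only [StepUp, not_or, not_not, not_lt]
  by_cases h : i < a
  · simp [h]
  · rw [show i - a - b = i - (a + b) by omega, show b ≤ i - a ↔ a + b ≤ i by omega]

/-- Each pair of parts d − 1, 1 is one period of length d, whose last step alone goes down. -/
theorem stepUp_fenceParts (hd : 1 < d) (hr : r ≤ d) {i : ℕ} (hi : i + 1 < q * d + r) :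
    StepUp (fenceParts d r q) i ↔ ¬ d ∣ i + 1 := by
  induction q generalizing i with
  | zero =>
    rw [fenceParts, if_neg (by omega)]
    exact iff_of_true (Or.inl (by omega)) (Nat.not_dvd_of_pos_of_lt (by omega) (by omega))
  | succ q ih =>
    rw [Nat.succ_mul] at hi
    rw [fenceParts, stepUp_cons_cons, show d - 1 + 1 = d by omega]
    rcases lt_trichotomy (i + 1) d with h | h | h
    · exact iff_of_true (Or.inl (by omega)) (Nat.not_dvd_of_pos_of_lt (by omega) h)
    · exact iff_of_false (by omega) (by simp [h])
    · rw [ih (by omega), show i + 1 = i - d + 1 + d by omega, Nat.dvd_add_self_right]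
      constructor
      · rintro (h' | ⟨_, h'⟩)
        · omega
        · exact h'
      · exact fun h' => Or.inr ⟨by omega, h'⟩

theorem stepUp_innerParts (hd : 1 < d) {i : ℕ} (hi : i < q * d + 1) :
    StepUp (innerParts d q) i ↔ d ∣ i := by
  induction q generalizing i with
  | zero =>
    obtain rfl : i = 0 := by omega
    exact iff_of_true (Or.inl one_pos) (dvd_zero d)
  | succ q ih =>
    rw [Nat.succ_mul] at hi
    rw [innerParts, stepUp_cons_cons, show 1 + (d - 1) = d by omega]
    rcases Nat.eq_zero_or_pos i with rfl | h0
    · exact iff_of_true (Or.inl one_pos) (dvd_zero d)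
    rcases lt_or_ge i d with h | h
    · exact iff_of_false (by omega) (Nat.not_dvd_of_pos_of_lt h0 h)
    · obtain ⟨t, rfl⟩ := Nat.exists_eq_add_of_le' h
      rw [Nat.add_sub_cancel, ih (by omega), Nat.dvd_add_self_right]
      constructor
      · rintro (h' | ⟨_, h'⟩)
        · omega
        · exact h'
      · exact fun h' => Or.inr ⟨h, h'⟩

/-- The composition belonging to the dual of the divided poset. -/
def fenceComposition (hd : 0 < d) (hq : q = 0 ∨ 1 < d) (hr : 0 < r) (hn : n = q * d + r) :
    Composition (n - 1) where
  blocks := fenceParts d r q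
  blocks_pos h := pos_of_mem_fenceParts hq hr h
  blocks_sum := by rw [sum_fenceParts hd hr, hn]

/-! ### The isomorphism from the dual poset to a fence -/

/-- The reversal of each of the blocks of the divided poset. -/
def flip (n d x : ℕ) : ℕ := x / d * d + (min d (n - x / d * d) - 1 - x % d)

theorem flip_mul_add {k i : ℕ} (hi : i < d) :
    flip n d (k * d + i) = k * d + (min d (n - k * d) - 1 - i) := by
  have h1 : (k * d + i) / d = k := by
    rw [mul_comm, Nat.mul_add_div (by omega), Nat.div_eq_of_lt hi, add_zero]
  have h2 : (k * d + i) % d = i := Nat.mul_add_mod_of_lt hi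
  rw [flip, h1, h2]

theorem exists_eq_mul_add (hd : 0 < d) (x : ℕ) : ∃ k i, i < d ∧ x = k * d + i :=
  ⟨x / d, x % d, Nat.mod_lt _ hd, (Nat.div_add_mod' x d).symm⟩

theorem flip_lt (hd : 0 < d) {x : ℕ} (hx : x < n) : flip n d x < n := by
  obtain ⟨k, i, hi, rfl⟩ := exists_eq_mul_add hd x
  rw [flip_mul_add hi]
  omega

theorem flip_flip (hd : 0 < d) {x : ℕ} (hx : x < n) : flip n d (flip n d x) = x := by
  obtain ⟨k, i, hi, rfl⟩ := exists_eq_mul_add hd x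
  rw [flip_mul_add hi, flip_mul_add (by omega)]
  omega

theorem mul_add_inj {k k' i i' : ℕ} (hi : i < d) (hi' : i' < d) :
    k' * d + i' = k * d + i ↔ k' = k ∧ i' = i := by
  constructor
  · intro h
    have h1 := congrArg (· / d) h
    simp only [mul_comm _ d, Nat.mul_add_div (show 0 < d by omega), Nat.div_eq_of_lt hi,
      Nat.div_eq_of_lt hi', add_zero] at h1
    subst h1
    exact ⟨rfl, by omega⟩
  · rintro ⟨rfl, rfl⟩
    rfl

theorem dvd_mul_add {k i : ℕ} (hi : i < d) : d ∣ k * d + i ↔ i = 0 := by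
  rw [Nat.dvd_add_right (Dvd.intro_left k rfl)]
  exact ⟨fun h => Nat.eq_zero_of_dvd_of_lt h hi, fun h => h ▸ dvd_zero d⟩

theorem mul_add_succ {k k' i i' : ℕ} (hi : i < d) (hi' : i' < d) :
    k' * d + i' = k * d + i + 1 ↔
      (k' = k ∧ i' = i + 1) ∨ (k' = k + 1 ∧ i' = 0 ∧ i + 1 = d) := by
  by_cases h : i + 1 < d
  · rw [add_assoc, mul_add_inj h hi']
    omega
  · rw [show k * d + i + 1 = (k + 1) * d + 0 by rw [Nat.succ_mul]; omega,
      mul_add_inj (by omega) hi']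
    omega

/-- In the dual order a block rises from its largest label to its smallest, so reversing each block
makes the path rise inside blocks. The step between blocks leads from the smallest label of one to
the largest of the next, which is a descent, at the positions i with d ∣ i + 1. -/
theorem fenceCover_flip_iff (hd : 0 < d) {l : List ℕ}
    (hl : ∀ i, i + 1 < n → (StepUp l i ↔ ¬ d ∣ i + 1)) {x y : ℕ} (hx : x < n) (hy : y < n) :
    FenceCover l (flip n d x) (flip n d y) ↔ DDividedCover n d (y + 1) (x + 1) := by
  have hx' := flip_lt hd hx
  have hy' := flip_lt hd hy
  have h1 : FenceCover l (flip n d x) (flip n d y) ↔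
      (flip n d y = flip n d x + 1 ∧ ¬ d ∣ flip n d y) ∨
        (flip n d x = flip n d y + 1 ∧ d ∣ flip n d x) := by
    rw [FenceCover]
    refine or_congr (and_congr_right fun h => ?_) (and_congr_right fun h => ?_)
    · rw [hl _ (by omega), h]
    · rw [hl _ (by omega), h, not_not]
  rw [h1, DDividedCover]
  clear h1 hl hx' hy'
  obtain ⟨k, i, hi, rfl⟩ := exists_eq_mul_add hd x
  obtain ⟨k', i', hi', rfl⟩ := exists_eq_mul_add hd y
  rw [flip_mul_add hi, flip_mul_add hi', mul_add_succ (by omega) (by omega),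
    mul_add_succ (by omega) (by omega), dvd_mul_add (by omega), dvd_mul_add (by omega),
    Nat.add_right_cancel_iff, mul_add_succ hi' hi]
  have h2 : (d ∣ k' * d + i' + 1) ↔ i' + 1 = d := by
    rw [add_assoc, Nat.dvd_add_right (Dvd.intro_left k' rfl)]
    exact ⟨fun h => le_antisymm hi' (Nat.le_of_dvd (by omega) h), fun h => h ▸ dvd_rfl⟩
  -- In block and offset coordinates, the cover joins offset 0 to the last offset of the next block,
  -- which may be shortened by n.
  have h3 : (∃ j, k' * d + i' + 1 = j * d + 1 ∧ (j + 1) * d < n ∧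
      k * d + i + 1 = min ((j + 2) * d) n) ↔
        i' = 0 ∧ k = k' + 1 ∧ i + 1 = min d (n - k * d) := by
    constructor
    · rintro ⟨j, e1, e2, e3⟩
      obtain ⟨rfl, rfl⟩ := (mul_add_inj (k' := k') (k := j) (i := 0) hd hi').1 (by omega)
      refine ⟨rfl, ?_⟩
      rw [show (k' + 2) * d = (k' + 1) * d + d by ring] at e3
      obtain ⟨e4, e5⟩ := (mul_add_inj (k' := k) (k := k' + 1) (i := min d (n - (k' + 1) * d) - 1)
        (by omega) hi).1 (by omega)
      subst e4
      exact ⟨rfl, by omega⟩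
    · rintro ⟨rfl, rfl, e⟩
      refine ⟨k', rfl, by omega, ?_⟩
      rw [show (k' + 2) * d = (k' + 1) * d + d by ring]
      omega
  rw [h2, h3]
  by_cases hk : k' = k
  · subst hk
    omega
  · by_cases hk' : k = k' + 1
    · subst hk'
      rw [Nat.succ_mul] at *
      omega
    · omega

/-- The dual of the divided poset is a fence. -/
def fenceIso (hn : 0 < n) (hd : 0 < d) (α : Composition (n - 1))
    (hα : ∀ i, i + 1 < n → (StepUp α.blocks i ↔ ¬ d ∣ i + 1)) : (DDivided n d)ᵒᵈ ≃o Fence α :=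
  let f : Fin n ≃ Fin n := Function.Involutive.toPerm
    (fun x => ⟨flip n d x, flip_lt hd x.2⟩) (fun x => Fin.ext (flip_flip hd x.2))
  let e : DDivided n d ≃ Fence α := f.trans (finCongr (show n = n - 1 + 1 by omega))
  { toEquiv := OrderDual.ofDual.trans e
    map_rel_iff' := by
      intro a b
      refine reflTransGen_apply_iff_swap (V := DDivided n d) (W := Fence α)
        (R := fun x y => DDividedCover n d x.label y.label)
        (R' := fun x y => FenceCover α.blocks x.pos y.pos) e ?_
      intro x y
      exact fenceCover_flip_iff hd hα (Fin.is_lt (n := n) x) (Fin.is_lt (n := n) y) }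

/-- The dual of the `1`-divided poset is a chain. -/
def fenceIsoOfOne (hn : 0 < n) (α : Composition (n - 1))
    (hα : ∀ i, i + 1 < n → StepUp α.blocks i) : (DDivided n 1)ᵒᵈ ≃o Fence α :=
  let e : DDivided n 1 ≃ Fence α :=
    (Fin.revPerm (n := n)).trans (finCongr (show n = n - 1 + 1 by omega))
  { toEquiv := OrderDual.ofDual.trans e
    map_rel_iff' := by
      intro a b
      refine reflTransGen_apply_iff_swap (V := DDivided n 1) (W := Fence α)
        (R := fun x y => DDividedCover n 1 x.label y.label)
        (R' := fun x y => FenceCover α.blocks x.pos y.pos) e ?_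
      intro x y
      obtain ⟨x, hx⟩ : Fin n := x
      obtain ⟨y, hy⟩ : Fin n := y
      change FenceCover α.blocks (n - (x + 1)) (n - (y + 1)) ↔ DDividedCover n 1 (y + 1) (x + 1)
      constructor
      · rintro (⟨h1, h2⟩ | ⟨h1, h2⟩)
        · exact Or.inr ⟨y, by omega, by omega, by omega⟩
        · exact absurd (hα _ (by omega)) h2
      · rintro (⟨h1, h2⟩ | ⟨k, h1, h2, h3⟩)
        · exact absurd (one_dvd _) h2
        · exact Or.inl ⟨by omega, hα _ (by omega)⟩ }

/-- For d > 1 and q > 0 there are 2q parts if r = 1 and 2q + 1 otherwise, so an odd number means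
that the outer parts are d − 1 and r − 1. -/
theorem exists_fence (hd : 0 < d) (hr0 : 0 < r) (hr : r ≤ d) (hn : n = q * d + r) :
    ∃ α : Composition (n - 1), Nonempty ((DDivided n d)ᵒᵈ ≃o Fence α) ∧
      (α.length = 1 → q = 0 ∨ r = d) ∧
      (3 ≤ α.length → Odd α.length → α.blocks.getLastD 0 ≤ α.blocks.headD 0 ∧
        (α.blocks.headD 0 = α.blocks.getLastD 0 → r = d ∧
          SymmetricSeq (fenceRankSeq (innerComposition α))
            (α.blocks.tail.dropLast.sum + 1))) := by
  rcases Nat.lt_or_ge 1 d with h1 | h1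
  · let α := fenceComposition hd (Or.inr h1) hr0 hn
    have hlen : α.length = (fenceParts d r q).length := rfl
    refine ⟨α, ⟨fenceIso (by omega) hd α fun i hi => stepUp_fenceParts h1 hr (hn ▸ hi)⟩,
      fun hl => ?_, fun h3 ho => ?_⟩
    · rcases q with _ | q
      · exact Or.inl rfl
      · simp [hlen, fenceParts] at hl
    · have hb : α.blocks = fenceParts d r q := rfl
      rcases q with _ | q
      · rw [hlen, fenceParts] at h3
        split_ifs at h3 <;> simp at h3
      rw [fenceParts_succ, fenceParts] at hb
      rw [hlen, fenceParts_succ, fenceParts] at ho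
      split_ifs at hb ho with h
      · rw [List.append_nil, List.length_cons, length_innerParts] at ho
        exact absurd ho (Nat.not_odd_iff_even.2 ⟨q + 1, by omega⟩)
      · have hin : α.blocks.tail.dropLast = innerParts d q := by
          rw [hb, List.tail_cons, List.dropLast_concat]
        have hlast : α.blocks.getLastD 0 = r - 1 := by
          rw [hb, ← List.cons_append, List.getLastD_concat]
        have hhead : α.blocks.headD 0 = d - 1 := by rw [hb, List.headD_cons]
        rw [hlast, hhead]
        refine ⟨by omega, fun e => ⟨by omega, Fence.symmetricSeq _ ?_⟩⟩
        -- The inner path has qd + 1 steps and rises exactly at multiples of d, a set invariant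
        -- under i ↦ qd − i.
        change ∀ i < α.blocks.tail.dropLast.sum, StepUp α.blocks.tail.dropLast
          (α.blocks.tail.dropLast.sum - 1 - i) ↔ StepUp α.blocks.tail.dropLast i
        rw [hin, sum_innerParts hd]
        intro i hi
        rw [stepUp_innerParts h1 (by omega), stepUp_innerParts h1 hi, Nat.add_sub_cancel,
          Nat.dvd_sub_iff_right (by omega) (Dvd.intro_left q rfl)]
  · obtain rfl : d = 1 := by omega
    obtain rfl : r = 1 := by omega
    -- For d = 1 the parts d − 1 would be zero. The poset is a chain, whose fence is that of a
    -- single block of size n.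
    let α : Composition (n - 1) :=
      fenceComposition (d := 1) (r := n) (q := 0) one_pos (Or.inl rfl) (by omega) (by omega)
    have hlen : α.length = (fenceParts 1 n 0).length := rfl
    refine ⟨α, ⟨fenceIsoOfOne (by omega) α ?_⟩, fun _ => Or.inr rfl, fun h3 => ?_⟩
    · intro i hi
      change StepUp (fenceParts 1 n 0) i
      rw [fenceParts, if_neg (by omega)]
      exact Or.inl (by omega)
    · rw [hlen, fenceParts] at h3
      split_ifs at h3 <;> simp at h3

end DDivided

theorem theorem5p1 (n d : ℕ) (hn : 0 < n) (hd : 0 < d) :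
    -- the lattice of order ideals of the `d`-divided poset
    (d ∣ n →
      (∃ 𝒞 : Set (SaturatedChain (LowerSet (DDivided n d))), IsNCD 𝒞 ∧ IsSymmetricCD 𝒞) ∧
      SymmetricSeq (rankSeq (LowerSet (DDivided n d))) (posetRank (LowerSet (DDivided n d)))) ∧
    (¬ d ∣ n →
      (∃ 𝒞 : Set (SaturatedChain (LowerSet (DDivided n d))), IsNCD 𝒞 ∧ IsTopCenteredCD 𝒞) ∧
      TopHeavySeq (rankSeq (LowerSet (DDivided n d))) (posetRank (LowerSet (DDivided n d))) ∧
      TopInterlacingSeq (rankSeq (LowerSet (DDivided n d)))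
        (posetRank (LowerSet (DDivided n d)))) ∧
    -- the dual poset is a fence, for which the conjecture on centered decompositions holds
    (∃ α : Composition (n - 1), Nonempty ((DDivided n d)ᵒᵈ ≃o Fence α) ∧
      CenteredConjectureHolds α ∧
      (d ∣ n → ∃ 𝒞 : Set (SaturatedChain (LowerSet (Fence α))), IsNCD 𝒞 ∧ IsSymmetricCD 𝒞) ∧
      (¬ d ∣ n →
        ∃ 𝒞 : Set (SaturatedChain (LowerSet (Fence α))), IsNCD 𝒞 ∧ IsBottomCenteredCD 𝒞)) := by
  -- Dividing n − 1 instead of n puts r in 1, …, d, so a last block always exists.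
  obtain ⟨q, r, hr0, hr, hnq⟩ : ∃ q r, 0 < r ∧ r ≤ d ∧ n = q * d + r := by
    refine ⟨(n - 1) / d, (n - 1) % d + 1, Nat.succ_pos _, Nat.mod_lt _ hd, ?_⟩
    have := Nat.div_add_mod' (n - 1) d
    omega
  have hdvd : d ∣ n → r = d := fun h => by
    rw [hnq, Nat.dvd_add_right (Dvd.intro_left q rfl)] at h
    exact le_antisymm hr (Nat.le_of_dvd hr0 h)
  let S := DDivided.chainSystem hr0 hr hnq
  have hS : S.IsTopCentered := DDivided.chainSystem_isTopCentered hr0 hr hnq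
  have hS' : q = 0 ∨ r = d → S.IsSymmetric := DDivided.chainSystem_isSymmetric hr0 hr hnq
  refine ⟨fun h => ?_, fun _ => ⟨⟨_, hS.isNCD⟩, hS.topHeavySeq, hS.topInterlacingSeq⟩, ?_⟩
  · have h := hS' (Or.inr (hdvd h))
    exact ⟨⟨_, h.isNCD⟩, h.symmetricSeq⟩
  · obtain ⟨α, ⟨e⟩, h1, h3⟩ := DDivided.exists_fence hd hr0 hr hnq
    refine ⟨α, ⟨e⟩, ?_, fun h => ⟨_, ((hS' (Or.inr (hdvd h))).dual e).isNCD⟩,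
      fun _ => ⟨_, (hS.dual e).isNCD⟩⟩
    refine centeredConjectureHolds_of_chainSystem α _ (hS.dual e)
      (fun h => (hS' (h1 h)).dual e) (fun hl ho => ⟨(h3 hl ho).1, fun h => ?_⟩)
    obtain ⟨h4, h5⟩ := (h3 hl ho).2 h
    exact ⟨(hS' (Or.inr h4)).dual e, h5⟩
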